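/- Let $\mathcal N$ be a semifinite von Neumann algebra acting on a separable complex Hilbert space $\mathcal H$, with a fixed faithful, normal, semifinite trace $\tau$. Let $\mathcal K$ be the norm-closed two-sided ideal of $\mathcal N$ generated by the projections of finite trace, and let $\pi:\mathcal N\to\mathcal N/\mathcal K$ be the quotient map, where $\mathcal N/\mathcal K$ carries the quotient norm. For a subspace $V$ of $\mathcal H$ write $[V]$ for the projection onto its closure. For projections $P,Q\in\mathcal N$, an operator $T\in P\mathcal NQ$ is called $(P\cdot Q)$ $\tau$-Fredholm if $[\ker T\cap Q(\mathcal H)]$ and $[\ker T^*\cap P(\mathcal H)]$ have finite trace and there is a projection $P'\le P$ in $\mathcal N$ with $\tau(P-P')<\infty$ and $P'(\mathcal H)\subseteq T(\mathcal H)$; its index is then $$\mathrm{Ind}_{(P\cdot Q)}(T)=\tau[\ker T\cap Q(\mathcal H)]-\tau[\ker T^*\cap P(\mathcal H)].$$ When $PQ$ is $(P\cdot Q)$ $\tau$-Fredholm, the essential codimension of $P$ in $Q$ is $ec(P,Q)=\mathrm{Ind}_{(P\cdot Q)}(PQ)$. (1) Let $P_1,P_2,P_3\in\mathcal N$ be projections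 with $\|\pi(P_1)-\pi(P_2)\|<\frac12$ and $\|\pi(P_2)-\pi(P_3)\|<\frac12$. Then $P_iP_j$ is $(P_i\cdot P_j)$ $\tau$-Fredholm for $(i,j)=(1,2),(2,3),(1,3)$, and $$ec(P_1,P_3)=ec(P_1,P_2)+ec(P_2,P_3).$$ (2) Consequently, spectral flow does not depend on the choice of partition. That is, let $\chi$ be the characteristic function of $[0,\infty)$, and let $\{B_t\}_{t\in[a,b]}$ be a norm-continuous path of self-adjoint operators in $\mathcal N$ such that every $\pi(B_t)$ is invertible in $\mathcal N/\mathcal K$. Then the number $$\sum_{i=1}^k ec\bigl(\chi(B_{t_{i-1}}),\chi(B_{t_i})\bigr)$$ is the same for all partitions $a=t_0<t_1<\dots<t_k=b$ such that $\|\pi(\chi(B_t))-\pi(\chi(B_s))\|<\frac12$ for all $i$ and all $t,s\in[t_{i-1},t_i]$. -/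

import Mathlib

open scoped NNReal ENNReal

noncomputable section

namespace BreuerFredholm

/-- A faithful, normal, semifinite trace `τ : N₊ → [0, ∞]` on a von Neumann algebra `N`.
The function is recorded on all of `N`, but every law concerns positive elements only and it is
only ever evaluated at positive elements. -/
structure FNSTrace {H : Type*} [NormedAddCommGroup H] [InnerProductSpace ℂ H] [CompleteSpace H]
    (N : VonNeumannAlgebra H) where
  /-- the value of the trace -/
  toFun : N → ℝ≥0∞
  map_add : ∀ x y : N, 0 ≤ x → 0 ≤ y → toFun (x + y) = toFun x + toFun y
  /-- `τ (r x) = r τ(x)` for real `r ≥ 0`, with `0 · ∞ = 0`. -/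
  map_smul : ∀ (r : ℝ≥0) (x y : N), 0 ≤ x →
    (y : H →L[ℂ] H) = ((r : ℝ) : ℂ) • (x : H →L[ℂ] H) → toFun y = (r : ℝ≥0∞) * toFun x
  /-- the trace property -/
  map_star_mul : ∀ x : N, toFun (star x * x) = toFun (x * star x)
  faithful : ∀ x : N, 0 ≤ x → toFun x = 0 → x = 0
  /-- `τ` commutes with suprema of bounded upward directed families of positive elements. -/
  normal : ∀ (S : Set N) (x : N), S.Nonempty → DirectedOn (· ≤ ·) S → (∀ s ∈ S, 0 ≤ s) →
    IsLUB S x → toFun x = ⨆ s ∈ S, toFun s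
  /-- `τ x` is the supremum of the finite values `τ y` with `0 ≤ y ≤ x`. -/
  semifinite : ∀ x : N, 0 ≤ x →
    toFun x = ⨆ y ∈ {y : N | 0 ≤ y ∧ y ≤ x ∧ toFun y < ∞}, toFun y

variable {H : Type*} [NormedAddCommGroup H] [InnerProductSpace ℂ H] [CompleteSpace H]
  {N : VonNeumannAlgebra H}

instance : CoeFun (FNSTrace N) (fun _ => N → ℝ≥0∞) := ⟨FNSTrace.toFun⟩

/-! ### The generalized Calkin algebra -/

/-- The norm-closed two-sided ideal `K` of `N` generated by the projections of finite trace. -/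
def compactIdeal (τ : FNSTrace N) : Ideal N :=
  sInf {I : Ideal N | I.IsTwoSided ∧ IsClosed (I : Set N) ∧
    ∀ p : N, IsStarProjection p → τ p < ∞ → p ∈ I}

instance compactIdeal_isTwoSided (τ : FNSTrace N) : (compactIdeal τ).IsTwoSided where
  mul_mem_of_left {a} b ha := by
    simp only [compactIdeal, Submodule.mem_sInf, Set.mem_ofPred_eq] at ha ⊢
    intro I hI
    exact hI.1.mul_mem_of_left b (ha I hI)

/-- The quotient ring `N / K`; as a quotient of normed spaces it carries the quotient norm. -/
abbrev CalkinAlgebra (τ : FNSTrace N) : Type _ := N ⧸ compactIdeal τ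

/-- The quotient map `π : N → N / K`. -/
def calkinMap (τ : FNSTrace N) : N →+* CalkinAlgebra τ := Ideal.Quotient.mk (compactIdeal τ)

/-! ### Projections onto subspaces attached to elements of `N` -/

/-- `ker_Q(T) = ker T ∩ Q(H)`. -/
def kerOn (Q T : N) : Submodule ℂ H :=
  LinearMap.ker ((T : H →L[ℂ] H) : H →ₗ[ℂ] H) ⊓ LinearMap.range ((Q : H →L[ℂ] H) : H →ₗ[ℂ] H)

/-- If a subspace is invariant under the commutant of `N`, then the projection onto its closure
belongs to `N`. -/
theorem starProjection_closure_mem (K : Submodule ℂ H)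
    (hK : ∀ y ∈ N.commutant, ∀ v ∈ K, y v ∈ K) : K.topologicalClosure.starProjection ∈ N := by
  rw [VonNeumannAlgebra.IsStarProjection.mem_iff isStarProjection_starProjection]
  intro y hy
  rw [Submodule.range_starProjection, Module.End.mem_invtSubmodule]
  intro v hv
  have h : Set.MapsTo y (K : Set H) (K : Set H) := fun v hv => hK y hy v hv
  exact h.closure y.continuous hv

/-- `[ker_Q(T)]`, the projection onto the closure of `ker_Q(T)`, as an element of `N`. -/
def kerProj (Q T : N) : N :=
  ⟨(kerOn Q T).topologicalClosure.starProjection, starProjection_closure_mem _ (by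
    rintro y hy v ⟨hv, w, rfl⟩
    rw [VonNeumannAlgebra.mem_commutant_iff] at hy
    have hT := hy T T.2
    have hQ := hy Q Q.2
    refine ⟨?_, y w, ?_⟩
    · have h := congrArg (fun S : H →L[ℂ] H => S ((Q : H →L[ℂ] H) w)) hT
      have hv' : (T : H →L[ℂ] H) ((Q : H →L[ℂ] H) w) = 0 := hv
      simpa [hv'] using h
    · simpa using congrArg (fun S : H →L[ℂ] H => S w) hQ)⟩

/-! ### Fredholm operators in a skew corner, index, essential codimension -/

/-- For projections `P`, `Q`, the element `T` of `P N Q` is `(P·Q)` `τ`-Fredholm. -/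
def IsTauFredholm (τ : FNSTrace N) (P Q T : N) : Prop :=
  P * T * Q = T ∧
  τ (kerProj Q T) < ∞ ∧ τ (kerProj P (star T)) < ∞ ∧
  ∃ P₁ : N, IsStarProjection P₁ ∧ P₁ ≤ P ∧ τ (P - P₁) < ∞ ∧
    LinearMap.range ((P₁ : H →L[ℂ] H) : H →ₗ[ℂ] H) ≤
      LinearMap.range ((T : H →L[ℂ] H) : H →ₗ[ℂ] H)

/-- The `(P·Q)`-index `τ[ker_Q T] - τ[ker_P T*]` of a `(P·Q)` `τ`-Fredholm element `T`. -/
def index (τ : FNSTrace N) (P Q T : N) : ℝ :=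
  (τ (kerProj Q T)).toReal - (τ (kerProj P (star T))).toReal

/-- The essential codimension of `P` in `Q`. -/
def ec (τ : FNSTrace N) (P Q : N) : ℝ := index τ P Q (P * Q)

/-! ### Spectral flow -/

/-- For self-adjoint `T`, the spectral projection `χ(T)` of `T` for the interval `[0, ∞)`.
The complementary spectral projection, for `(-∞, 0)`, is the support projection of the negative
part `T⁻ = max (-T) 0`, so `χ(T)` is the projection onto the (closed) subspace `ker T⁻`. -/
def chi (T : N) : N :=
  ⟨(LinearMap.ker (((T : H →L[ℂ] H)⁻ : H →L[ℂ] H) : H →ₗ[ℂ] H)).topologicalClosure.starProjection,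
    starProjection_closure_mem _ (by
      intro y hy v hv
      rw [VonNeumannAlgebra.mem_commutant_iff] at hy
      have hT : Commute (T : H →L[ℂ] H) y := hy T T.2
      have h : Commute ((T : H →L[ℂ] H)⁻) y := by
        rw [CFC.negPart_def]
        exact hT.cfcₙ_real _
      have h' := congrArg (fun S : H →L[ℂ] H => S v) h.eq
      have hv' : ((T : H →L[ℂ] H)⁻) v = 0 := hv
      simpa [hv'] using h')⟩

/-- `F^sa`: the self-adjoint elements of `N` that are invertible modulo `K`. -/
def SelfAdjointFredholm (τ : FNSTrace N) : Set N :=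
  {T : N | IsSelfAdjoint T ∧ IsUnit (calkinMap τ T)}

/-- A partition `a = t 0 < t 1 < ⋯ < t k = b` such that on each `[t i, t (i+1)]` the projections
`π(χ(B_r))` are at mutual distance less than `1/2`. -/
structure IsFlowPartition (τ : FNSTrace N) (B : ℝ → N) (a b : ℝ) {k : ℕ}
    (t : Fin (k + 1) → ℝ) : Prop where
  strictMono : StrictMono t
  left : t 0 = a
  right : t (Fin.last k) = b
  close : ∀ i : Fin k, ∀ r ∈ Set.Icc (t i.castSucc) (t i.succ),
    ∀ s ∈ Set.Icc (t i.castSucc) (t i.succ),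
      ‖calkinMap τ (chi (B r)) - calkinMap τ (chi (B s))‖ < 1 / 2

/-- The spectral flow of the path `B` computed with the partition `t`. -/
def flowSum (τ : FNSTrace N) (B : ℝ → N) {k : ℕ} (t : Fin (k + 1) → ℝ) : ℝ :=
  ∑ i : Fin k, ec τ (chi (B (t i.castSucc))) (chi (B (t i.succ)))

end BreuerFredholm

end

/-! The trace gives closed subspaces invariant under the commutant a dimension in [0, ∞], and the
argument is linear algebra with this dimension. Its foundation is `dim_range`: the range of `T` is
as large as the orthogonal complement of its kernel. With X = T(T*T + ε)^{-1/2}, the operators XX*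
and X*X increase strongly, as ε decreases to 0, to the projections onto these two subspaces.
Normality and τ(XX*) = τ(X*X) then give equality. Rank–nullity (`dim_ker_add_dim_map`) follows.

Call a closed affiliated subspace cofinite if its complement has finite dimension. An element of the
compact ideal is arbitrarily small on suitable cofinite subspaces, so a bound ‖π(A)‖ < r becomes
‖Ax‖ ≤ c‖x‖ with c < r on a cofinite subspace (`exists_cofinite_of_norm_calkinMap_lt`).

If `P` is within c < 1 of the identity on a closed E ⊆ ran Q, then PE is closed, and counting
dimensions gives ec(P, Q) = dim(ran Q ⊖ E) - dim(ran P ⊖ PE) whenever both terms are finite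
(`isTauFredholm_and_ec_eq`). For three projections take E ⊆ ran P₃ and its images P₂E and P₁P₂E: the
codimensions telescope, up to replacing P₁P₂E by P₁E. Both P₁P₂ and P₁ are near the identity on E,
so these images have equal codimension in ran P₁ (`dim_ran_inf_orthogonal_image_eq`).

Thus ec is additive along each interval of an admissible partition, and two partitions are compared
through their common refinement (`sum_partition_eq`). -/

noncomputable section

namespace BreuerFredholm

open Filter Topology

/-! ### Range and support projections as strong limits -/

section Regularization

variable {H : Type*} [NormedAddCommGroup H] [InnerProductSpace ℂ H] [CompleteSpace H]

/-- Contractions that converge pointwise to the identity on `V` and vanish on `Vᗮ` converge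
pointwise to the projection onto the closure of `V`. -/
theorem tendsto_starProjection_closure {A : ℕ → H →L[ℂ] H} {V : Submodule ℂ H}
    (hA : ∀ n, ‖A n‖ ≤ 1) (hV : ∀ y ∈ V, Tendsto (fun n => A n y) atTop (𝓝 y))
    (hV' : ∀ y ∈ Vᗮ, ∀ n, A n y = 0) (x : H) :
    Tendsto (fun n => A n x) atTop (𝓝 (V.topologicalClosure.starProjection x)) := by
  set p := V.topologicalClosure.starProjection x with hp
  have hpV : p ∈ V.topologicalClosure := Submodule.starProjection_apply_mem _ _
  have hq : x - p ∈ Vᗮ := by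
    rw [← Submodule.orthogonal_closure]
    exact Submodule.sub_starProjection_mem_orthogonal _
  have hAx : ∀ n, A n x = A n p := fun n => by
    have := hV' _ hq n
    rwa [map_sub, sub_eq_zero] at this
  simp only [hAx]
  rw [Metric.tendsto_atTop]
  intro ε hε
  obtain ⟨y, hy, hyp⟩ := Metric.mem_closure_iff.1 hpV (ε / 3) (by positivity)
  obtain ⟨n₀, hn₀⟩ := Metric.tendsto_atTop.1 (hV y hy) (ε / 3) (by positivity)
  refine ⟨n₀, fun n hn => ?_⟩
  have h1 : dist (A n p) (A n y) ≤ dist p y := by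
    rw [dist_eq_norm, dist_eq_norm, ← map_sub]
    simpa using (A n).le_of_opNorm_le (hA n) (p - y)
  have h2 := hn₀ n hn
  have h3 := dist_triangle4 (A n p) (A n y) y p
  rw [dist_comm y p] at h3
  linarith

/-- The function `x ↦ (|x| + 1/(n+1))^{-1/2}` applied to `T* T`. -/
def reg (T : H →L[ℂ] H) (n : ℕ) : H →L[ℂ] H :=
  cfc (fun x : ℝ => (√(|x| + 1 / ((n : ℝ) + 1)))⁻¹) (star T * T)

/-- The absolute value makes the regularizing function positive and continuous on all of ℝ; on the
spectrum of T*T it changes nothing. -/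
theorem abs_add_one_div_pos (n : ℕ) (x : ℝ) : 0 < |x| + 1 / ((n : ℝ) + 1) := by positivity

theorem continuous_regFun (n : ℕ) :
    Continuous (fun x : ℝ => (√(|x| + 1 / ((n : ℝ) + 1)))⁻¹) :=
  Continuous.inv₀ (by fun_prop) fun x => (Real.sqrt_pos.2 (abs_add_one_div_pos n x)).ne'

theorem continuous_regFun_sq (n : ℕ) :
    Continuous (fun x : ℝ => (|x| + 1 / ((n : ℝ) + 1))⁻¹) :=
  Continuous.inv₀ (by fun_prop) fun x => (abs_add_one_div_pos n x).ne'

theorem isSelfAdjoint_reg (T : H →L[ℂ] H) (n : ℕ) : IsSelfAdjoint (reg T n) :=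
  cfc_predicate _ _

theorem reg_mul_reg (T : H →L[ℂ] H) (n : ℕ) :
    reg T n * reg T n = cfc (fun x : ℝ => (|x| + 1 / ((n : ℝ) + 1))⁻¹) (star T * T) := by
  rw [reg, ← cfc_mul _ _ _ (continuous_regFun n).continuousOn (continuous_regFun n).continuousOn]
  congr 1
  funext x
  rw [← mul_inv, Real.mul_self_sqrt (abs_add_one_div_pos n x).le]

theorem commute_reg (T : H →L[ℂ] H) (n : ℕ) : Commute (reg T n) (star T * T) :=
  (Commute.refl (star T * T)).cfc_real _

theorem reg_conj (T : H →L[ℂ] H) (n : ℕ) :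
    reg T n * (star T * T) * reg T n = reg T n * reg T n * (star T * T) := by
  rw [mul_assoc, ← (commute_reg T n).eq, mul_assoc]

theorem reg_conj_eq_cfc (T : H →L[ℂ] H) (n : ℕ) :
    reg T n * (star T * T) * reg T n =
      cfc (fun x : ℝ => (|x| + 1 / ((n : ℝ) + 1))⁻¹ * x) (star T * T) := by
  have ha : IsSelfAdjoint (star T * T) := IsSelfAdjoint.star_mul_self T
  rw [reg_conj, reg_mul_reg]
  rw [cfc_mul _ _ _ (continuous_regFun_sq n).continuousOn (continuousOn_id' _),
    cfc_id' ℝ (star T * T)]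

theorem spectrum_star_mul_self_nonneg (T : H →L[ℂ] H) {x : ℝ} (hx : x ∈ spectrum ℝ (star T * T)) :
    0 ≤ x :=
  spectrum_nonneg_of_nonneg (star_mul_self_nonneg T) hx

theorem reg_mul_reg_mono (T : H →L[ℂ] H) : Monotone fun n => reg T n * reg T n := by
  intro n m hnm
  simp only [reg_mul_reg]
  refine cfc_mono (fun x _ => ?_) (continuous_regFun_sq n).continuousOn
    (continuous_regFun_sq m).continuousOn
  have := abs_add_one_div_pos m x
  gcongr

theorem reg_conj_mono (T : H →L[ℂ] H) : Monotone fun n => reg T n * (star T * T) * reg T n := by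
  intro n m hnm
  simp only [reg_conj_eq_cfc]
  refine cfc_mono (fun x hx => ?_) ((continuous_regFun_sq n).mul continuous_id').continuousOn
    ((continuous_regFun_sq m).mul continuous_id').continuousOn
  have := abs_add_one_div_pos m x
  have := spectrum_star_mul_self_nonneg T hx
  gcongr

theorem norm_reg_conj_le (T : H →L[ℂ] H) (n : ℕ) : ‖reg T n * (star T * T) * reg T n‖ ≤ 1 := by
  rw [reg_conj_eq_cfc]
  refine norm_cfc_le zero_le_one fun x _ => ?_
  have h := abs_add_one_div_pos n x
  have h' : (0 : ℝ) ≤ 1 / ((n : ℝ) + 1) := by positivity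
  rw [norm_mul, norm_inv, Real.norm_eq_abs, Real.norm_eq_abs, abs_of_pos h, inv_mul_le_iff₀ h]
  linarith

/-- With ε = 1/(n+1), the function is x²/(x + ε) - x = -ε · x/(x + ε), and 0 ≤ x/(x + ε) ≤ 1 for x ≥
0. This gives convergence to the identity on the range of T*T. -/
theorem norm_reg_conj_mul_sub_le (T : H →L[ℂ] H) (n : ℕ) :
    ‖reg T n * (star T * T) * reg T n * (star T * T) - star T * T‖ ≤ 1 / ((n : ℝ) + 1) := by
  have ha : IsSelfAdjoint (star T * T) := IsSelfAdjoint.star_mul_self T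
  have hc : Continuous (fun x : ℝ => (|x| + 1 / ((n : ℝ) + 1))⁻¹ * x) :=
    (continuous_regFun_sq n).mul continuous_id'
  have : reg T n * (star T * T) * reg T n * (star T * T) - star T * T =
      cfc (fun x : ℝ => (|x| + 1 / ((n : ℝ) + 1))⁻¹ * x * x - x) (star T * T) := by
    rw [cfc_sub (fun x : ℝ => (|x| + 1 / ((n : ℝ) + 1))⁻¹ * x * x) (fun x => x) _
        (hc.mul continuous_id').continuousOn (continuousOn_id' _),
      cfc_mul _ _ _ hc.continuousOn (continuousOn_id' _), cfc_id' ℝ (star T * T), reg_conj_eq_cfc]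
  rw [this]
  refine norm_cfc_le (by positivity) fun x hx => ?_
  have h := abs_add_one_div_pos n x
  have hx0 := spectrum_star_mul_self_nonneg T hx
  rw [abs_of_nonneg hx0] at h ⊢
  have e : (x + 1 / ((n : ℝ) + 1))⁻¹ * x * x - x =
      -((1 / ((n : ℝ) + 1)) * ((x + 1 / ((n : ℝ) + 1))⁻¹ * x)) := by
    field_simp
    ring
  have h0 : (0 : ℝ) ≤ 1 / ((n : ℝ) + 1) := by positivity
  have h1 : (x + 1 / ((n : ℝ) + 1))⁻¹ * x ≤ 1 := by
    rw [inv_mul_le_iff₀ h]; linarith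
  rw [e, norm_neg, Real.norm_eq_abs, abs_of_nonneg (by positivity)]
  exact mul_le_of_le_one_right h0 h1

theorem reg_conj_apply_of_apply_eq_zero (T : H →L[ℂ] H) {y : H} (hy : T y = 0) (n : ℕ) :
    (reg T n * (star T * T) * reg T n) y = 0 := by
  rw [reg_conj]
  simp [hy]

theorem orthogonal_range_star_mul_self (T : H →L[ℂ] H) :
    (LinearMap.range ((star T * T : H →L[ℂ] H) : H →ₗ[ℂ] H))ᗮ = LinearMap.ker (T : H →ₗ[ℂ] H) := by
  ext y
  rw [Submodule.mem_orthogonal, LinearMap.mem_ker]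
  constructor
  · intro h
    have h1 := h _ ⟨y, rfl⟩
    have h2 : inner ℂ (T y) (T y) = 0 := by
      rw [← ContinuousLinearMap.adjoint_inner_left]
      exact h1
    exact inner_self_eq_zero.1 h2
  · rintro h _ ⟨z, rfl⟩
    change inner ℂ (ContinuousLinearMap.adjoint T (T z)) y = 0
    rw [ContinuousLinearMap.adjoint_inner_left]
    have h' : T y = 0 := h
    rw [h', inner_zero_right]

theorem tendsto_reg_conj (T : H →L[ℂ] H) (x : H) :
    Tendsto (fun n => (reg T n * (star T * T) * reg T n) x) atTop
      (𝓝 ((LinearMap.ker (T : H →ₗ[ℂ] H))ᗮ.topologicalClosure.starProjection x)) := by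
  have hcl : (LinearMap.ker (T : H →ₗ[ℂ] H))ᗮ.topologicalClosure =
      (LinearMap.range ((star T * T : H →L[ℂ] H) : H →ₗ[ℂ] H)).topologicalClosure := by
    rw [(Submodule.isClosed_orthogonal _).submodule_topologicalClosure_eq,
      ← orthogonal_range_star_mul_self, Submodule.orthogonal_orthogonal_eq_closure]
  simp only [hcl]
  refine tendsto_starProjection_closure (norm_reg_conj_le T) ?_ ?_ x
  · rintro _ ⟨z, rfl⟩
    rw [tendsto_iff_norm_sub_tendsto_zero]
    refine squeeze_zero (fun _ => norm_nonneg _)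
      (fun n => (reg T n * (star T * T) * reg T n * (star T * T) - star T * T).le_of_opNorm_le
        (norm_reg_conj_mul_sub_le T n) z) ?_
    simpa using (tendsto_one_div_add_atTop_nhds_zero_nat (𝕜 := ℝ)).mul_const ‖z‖
  · intro y hy n
    rw [orthogonal_range_star_mul_self] at hy
    exact reg_conj_apply_of_apply_eq_zero T hy n

theorem tendsto_mul_reg_mul (T : H →L[ℂ] H) (x : H) :
    Tendsto (fun n => (T * (reg T n * reg T n) * star T) x) atTop
      (𝓝 ((LinearMap.range (T : H →ₗ[ℂ] H)).topologicalClosure.starProjection x)) := by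
  refine tendsto_starProjection_closure (fun n => ?_) ?_ ?_ x
  · have h := norm_reg_conj_le T n
    have h1 : reg T n * (star T * T) * reg T n = star (T * reg T n) * (T * reg T n) := by
      rw [star_mul, (isSelfAdjoint_reg T n).star_eq]
      simp only [mul_assoc]
    have h2 : T * (reg T n * reg T n) * star T = (T * reg T n) * star (T * reg T n) := by
      rw [star_mul, (isSelfAdjoint_reg T n).star_eq]
      simp only [mul_assoc]
    rw [h1, CStarRing.norm_star_mul_self] at h
    rwa [h2, CStarRing.norm_self_mul_star]
  · rintro _ ⟨z, rfl⟩
    -- Since `reg T n` commutes with T*T, the n-th operator sends Tz to T applied to the n-th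
    -- support approximant of z. The limit is T of the component of z orthogonal to ker T, which is
    -- Tz.
    have h := (T.continuous.tendsto _).comp (tendsto_reg_conj T z)
    have hz : T ((LinearMap.ker (T : H →ₗ[ℂ] H))ᗮ.topologicalClosure.starProjection z) = T z := by
      have h0 := Submodule.sub_starProjection_mem_orthogonal
        (K := (LinearMap.ker (T : H →ₗ[ℂ] H))ᗮ.topologicalClosure) z
      rw [Submodule.orthogonal_closure, Submodule.orthogonal_orthogonal_eq_closure,
        T.isClosed_ker.submodule_topologicalClosure_eq] at h0
      have h0' : T (z - (LinearMap.ker (T : H →ₗ[ℂ] H))ᗮ.topologicalClosure.starProjection z) = 0 :=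
        h0
      rw [map_sub, sub_eq_zero] at h0'
      exact h0'.symm
    rw [hz] at h
    refine h.congr fun n => ?_
    simp only [Function.comp_apply, reg_conj]
    rfl
  · intro y hy n
    have : star T y = 0 := by
      have h : y ∈ LinearMap.ker (ContinuousLinearMap.adjoint T : H →ₗ[ℂ] H) := by
        rw [← ContinuousLinearMap.orthogonal_range]; exact hy
      exact h
    simp [this]

end Regularization

/-! ### Normality of the trace and the dimension of affiliated subspaces -/

section Trace

variable {H : Type*} [NormedAddCommGroup H] [InnerProductSpace ℂ H] [CompleteSpace H]
  {N : VonNeumannAlgebra H} (τ : FNSTrace N)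

theorem reg_mem {T : H →L[ℂ] H} (hT : T ∈ N) (n : ℕ) : reg T n ∈ N := by
  rw [← N.commutant_commutant, VonNeumannAlgebra.mem_commutant_iff]
  intro y hy
  have h : Commute (star T * T) y := by
    rw [VonNeumannAlgebra.mem_commutant_iff] at hy
    exact hy _ (mul_mem (star_mem hT) hT)
  exact ((h.cfc_real _).eq).symm

theorem coe_star_mul_self_nonneg (X : N) : 0 ≤ star X * X := by
  change (0 : H →L[ℂ] H) ≤ star (X : H →L[ℂ] H) * X
  exact star_mul_self_nonneg _

theorem coe_mul_star_self_nonneg (X : N) : 0 ≤ X * star X := by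
  change (0 : H →L[ℂ] H) ≤ (X : H →L[ℂ] H) * star (X : H →L[ℂ] H)
  exact mul_star_self_nonneg _

open ComplexOrder in
/-- The trace of a strong limit of an increasing sequence of positive elements. -/
theorem trace_eq_iSup {A : ℕ → N} {B : N} (hA : Monotone A) (h0 : ∀ n, 0 ≤ A n)
    (hB : ∀ x, Tendsto (fun n => (A n : H →L[ℂ] H) x) atTop (𝓝 ((B : H →L[ℂ] H) x))) :
    τ B = ⨆ n, τ (A n) := by
  have hlub : IsLUB (Set.range A) B := by
    -- The order is tested on quadratic forms, where strong limits preserve inequalities; so the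
    -- strong limit is the least upper bound.
    have key : ∀ (C D : N), (∀ x, (0 : ℂ) ≤ inner ℂ (((D : H →L[ℂ] H) - C) x) x) → C ≤ D := by
      intro C D h
      change (C : H →L[ℂ] H) ≤ D
      rw [ContinuousLinearMap.le_def, ContinuousLinearMap.isPositive_iff_complex]
      intro x
      obtain ⟨h1, h2⟩ := Complex.nonneg_iff.1 (h x)
      exact ⟨Complex.ext (by simp) (Eq.trans (by simp) h2), h1⟩
    have key' : ∀ (C D : N), C ≤ D → ∀ x, (0 : ℂ) ≤ inner ℂ (((D : H →L[ℂ] H) - C) x) x := by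
      intro C D h x
      have h' : (C : H →L[ℂ] H) ≤ D := h
      rw [ContinuousLinearMap.le_def, ContinuousLinearMap.isPositive_iff_complex] at h'
      obtain ⟨h1, h2⟩ := h' x
      rw [← h1]
      exact Complex.zero_le_real.2 h2
    constructor
    · rintro _ ⟨n, rfl⟩
      refine key _ _ fun x => ?_
      have ht : Tendsto (fun m => inner ℂ (((A m : H →L[ℂ] H) - A n) x) x) atTop
          (𝓝 (inner ℂ (((B : H →L[ℂ] H) - A n) x) x)) := by
        simp only [sub_apply]
        exact ((hB x).sub_const _).inner tendsto_const_nhds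
      refine ge_of_tendsto ht ?_
      filter_upwards [eventually_ge_atTop n] with m hm using key' _ _ (hA hm) x
    · intro D hD
      refine key _ _ fun x => ?_
      have ht : Tendsto (fun m => inner ℂ (((D : H →L[ℂ] H) - A m) x) x) atTop
          (𝓝 (inner ℂ (((D : H →L[ℂ] H) - B) x) x)) := by
        simp only [sub_apply]
        exact ((hB x).const_sub _).inner tendsto_const_nhds
      exact ge_of_tendsto' ht fun m => key' _ _ (hD ⟨m, rfl⟩) x
  have := τ.normal (Set.range A) B (Set.range_nonempty A) hA.directed_le.directedOn_range
    (by rintro _ ⟨n, rfl⟩; exact h0 n) hlub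
  rw [this, iSup_range]

/-- A subspace is affiliated with `N` if it is invariant under the commutant of `N`. -/
def Affiliated (N : VonNeumannAlgebra H) (V : Submodule ℂ H) : Prop :=
  ∀ y ∈ N.commutant, ∀ v ∈ V, y v ∈ V

/-- The projection onto the closure of an affiliated subspace. -/
def proj {V : Submodule ℂ H} (hV : Affiliated N V) : N :=
  ⟨V.topologicalClosure.starProjection, starProjection_closure_mem V hV⟩

open Classical in
/-- The dimension of an affiliated subspace, relative to the trace `τ`. -/
def dim (V : Submodule ℂ H) : ℝ≥0∞ := if h : Affiliated N V then τ (proj h) else 0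

variable {τ}

theorem dim_eq {V : Submodule ℂ H} (h : Affiliated N V) : dim τ V = τ (proj h) := dif_pos h

theorem Affiliated.inf {V W : Submodule ℂ H} (hV : Affiliated N V) (hW : Affiliated N W) :
    Affiliated N (V ⊓ W) := fun y hy v hv => ⟨hV y hy v hv.1, hW y hy v hv.2⟩

theorem Affiliated.orthogonal {V : Submodule ℂ H} (hV : Affiliated N V) : Affiliated N Vᗮ := by
  intro y hy v hv
  rw [Submodule.mem_orthogonal] at hv ⊢
  intro u hu
  rw [← ContinuousLinearMap.adjoint_inner_left]
  exact hv _ (hV _ (star_mem hy) u hu)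

theorem Affiliated.closure {V : Submodule ℂ H} (hV : Affiliated N V) :
    Affiliated N V.topologicalClosure := by
  rw [← Submodule.orthogonal_orthogonal_eq_closure]
  exact hV.orthogonal.orthogonal

theorem affiliated_top : Affiliated N (⊤ : Submodule ℂ H) := fun _ _ _ _ => trivial

theorem affiliated_bot : Affiliated N (⊥ : Submodule ℂ H) := by
  rintro y - v hv
  rw [Submodule.mem_bot] at hv ⊢
  rw [hv, map_zero]

theorem commutant_apply {y : H →L[ℂ] H} (hy : y ∈ N.commutant) (T : N) (v : H) :
    y ((T : H →L[ℂ] H) v) = (T : H →L[ℂ] H) (y v) := by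
  rw [VonNeumannAlgebra.mem_commutant_iff] at hy
  exact (congrArg (fun S : H →L[ℂ] H => S v) (hy T T.2)).symm

theorem Affiliated.map {V : Submodule ℂ H} (hV : Affiliated N V) (T : N) :
    Affiliated N (V.map ((T : H →L[ℂ] H) : H →ₗ[ℂ] H)) := by
  rintro y hy _ ⟨v, hv, rfl⟩
  exact ⟨y v, hV y hy v hv, (commutant_apply hy T v).symm⟩

theorem Affiliated.comap {V : Submodule ℂ H} (hV : Affiliated N V) (T : N) :
    Affiliated N (V.comap ((T : H →L[ℂ] H) : H →ₗ[ℂ] H)) := by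
  intro y hy v hv
  change (T : H →L[ℂ] H) (y v) ∈ V
  rw [← commutant_apply hy]
  exact hV y hy _ hv

theorem affiliated_ker (T : N) : Affiliated N (LinearMap.ker ((T : H →L[ℂ] H) : H →ₗ[ℂ] H)) := by
  rw [← Submodule.comap_bot]
  exact affiliated_bot.comap T

theorem affiliated_range (T : N) :
    Affiliated N (LinearMap.range ((T : H →L[ℂ] H) : H →ₗ[ℂ] H)) := by
  rw [LinearMap.range_eq_map]
  exact affiliated_top.map T

theorem isStarProjection_proj {V : Submodule ℂ H} (hV : Affiliated N V) :
    IsStarProjection (proj hV) :=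
  ⟨Subtype.ext (isStarProjection_starProjection
      (U := V.topologicalClosure)).isIdempotentElem.eq,
    Subtype.ext (isStarProjection_starProjection (U := V.topologicalClosure)).isSelfAdjoint.star_eq⟩

theorem proj_nonneg {V : Submodule ℂ H} (hV : Affiliated N V) : 0 ≤ proj hV :=
  (isStarProjection_starProjection (U := V.topologicalClosure)).nonneg

/-- The closures of the ranges of `T` and `T*` have the same dimension. -/
theorem dim_range (T : N) : dim τ (LinearMap.range ((T : H →L[ℂ] H) : H →ₗ[ℂ] H)) =
    dim τ (LinearMap.ker ((T : H →L[ℂ] H) : H →ₗ[ℂ] H))ᗮ := by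
  rw [dim_eq (affiliated_range T), dim_eq (affiliated_ker T).orthogonal]
  obtain ⟨G, hG⟩ : ∃ G : ℕ → N, ∀ n, (G n : H →L[ℂ] H) = reg T n :=
    ⟨fun n => ⟨reg T n, reg_mem T.2 n⟩, fun n => rfl⟩
  have hGs : ∀ n, star (G n) = G n := fun n => by
    apply Subtype.ext
    change star (G n : H →L[ℂ] H) = G n
    rw [hG, (isSelfAdjoint_reg (T : H →L[ℂ] H) n).star_eq]
  -- The two approximants are XX* and X*X for the same X = T * G n, so they have equal trace.
  have e1 : ∀ n, T * (G n * G n) * star T = T * G n * star (T * G n) := fun n => by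
    rw [star_mul, hGs]; simp only [mul_assoc]
  have e2 : ∀ n, G n * (star T * T) * G n = star (T * G n) * (T * G n) := fun n => by
    rw [star_mul, hGs]; simp only [mul_assoc]
  have c1 : ∀ n, ((T * (G n * G n) * star T : N) : H →L[ℂ] H) =
      (T : H →L[ℂ] H) * (reg T n * reg T n) * star (T : H →L[ℂ] H) := fun n => by
    rw [← hG]; rfl
  have c2 : ∀ n, ((G n * (star T * T) * G n : N) : H →L[ℂ] H) =
      reg (T : H →L[ℂ] H) n * (star (T : H →L[ℂ] H) * (T : H →L[ℂ] H)) *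
        reg (T : H →L[ℂ] H) n := fun n => by
    rw [← hG]; rfl
  have h1 : τ (proj (affiliated_range T)) = ⨆ n, τ (T * (G n * G n) * star T) := by
    refine trace_eq_iSup τ (fun n m hnm => ?_) (fun n => ?_) (fun x => ?_)
    · rw [← Subtype.coe_le_coe, c1, c1]
      exact star_right_conjugate_le_conjugate (reg_mul_reg_mono (T : H →L[ℂ] H) hnm) _
    · rw [e1]
      exact coe_mul_star_self_nonneg _
    · simp only [c1]
      exact tendsto_mul_reg_mul (T : H →L[ℂ] H) x
  have h2 : τ (proj (affiliated_ker T).orthogonal) = ⨆ n, τ (G n * (star T * T) * G n) := by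
    refine trace_eq_iSup τ (fun n m hnm => ?_) (fun n => ?_) (fun x => ?_)
    · rw [← Subtype.coe_le_coe, c2, c2]
      exact reg_conj_mono (T : H →L[ℂ] H) hnm
    · rw [e2]
      exact coe_star_mul_self_nonneg _
    · simp only [c2]
      exact tendsto_reg_conj (T : H →L[ℂ] H) x
  rw [h1, h2]
  congr 1
  funext n
  rw [e1, e2, τ.map_star_mul]

end Trace

theorem starProjection_congr {H : Type*} [NormedAddCommGroup H]
    [InnerProductSpace ℂ H] {U V : Submodule ℂ H} [U.HasOrthogonalProjection]
    [V.HasOrthogonalProjection] (h : U = V) : U.starProjection = V.starProjection := by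
  subst h; rfl

/-! ### Rank–nullity and cofinite subspaces -/

section Dimension

variable {H : Type*} [NormedAddCommGroup H] [InnerProductSpace ℂ H] [CompleteSpace H]
  {N : VonNeumannAlgebra H} {τ : FNSTrace N}

section Proj

variable {V : Submodule ℂ H} (hV : Affiliated N V)

theorem proj_mem (hc : IsClosed (V : Set H)) (x : H) : (proj hV : H →L[ℂ] H) x ∈ V := by
  exact hc.submodule_topologicalClosure_eq.le
    (Submodule.starProjection_apply_mem V.topologicalClosure x)

theorem sub_proj_mem (x : H) : x - (proj hV : H →L[ℂ] H) x ∈ Vᗮ := by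
  rw [← Submodule.orthogonal_closure]
  exact Submodule.sub_starProjection_mem_orthogonal _

theorem proj_apply_of_mem {x : H} (hx : x ∈ V) : (proj hV : H →L[ℂ] H) x = x :=
  Submodule.starProjection_eq_self_iff.2 (V.le_topologicalClosure hx)

theorem proj_apply_of_mem_orthogonal {x : H} (hx : x ∈ Vᗮ) : (proj hV : H →L[ℂ] H) x = 0 := by
  rw [← Submodule.orthogonal_closure] at hx
  exact (Submodule.starProjection_apply_eq_zero_iff _).2 hx

theorem range_proj (hc : IsClosed (V : Set H)) :
    LinearMap.range ((proj hV : H →L[ℂ] H) : H →ₗ[ℂ] H) = V := by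
  ext x
  constructor
  · rintro ⟨y, rfl⟩
    exact proj_mem hV hc y
  · intro hx
    exact ⟨x, proj_apply_of_mem hV hx⟩

end Proj

section StarProjection

variable {P : N}

theorem proj_apply_apply (hP : IsStarProjection P) (x : H) :
    (P : H →L[ℂ] H) ((P : H →L[ℂ] H) x) = (P : H →L[ℂ] H) x :=
  congrArg (fun S : N => (S : H →L[ℂ] H) x) hP.isIdempotentElem.eq

theorem proj_inner (hP : IsStarProjection P) (x y : H) :
    inner ℂ ((P : H →L[ℂ] H) x) y = inner ℂ x ((P : H →L[ℂ] H) y) := by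
  have h : ContinuousLinearMap.adjoint (P : H →L[ℂ] H) = P :=
    congrArg (fun S : N => (S : H →L[ℂ] H)) hP.isSelfAdjoint.star_eq
  conv_lhs => rw [← h]
  exact ContinuousLinearMap.adjoint_inner_left _ _ _

theorem mem_range_iff (hP : IsStarProjection P) {x : H} :
    x ∈ LinearMap.range ((P : H →L[ℂ] H) : H →ₗ[ℂ] H) ↔ (P : H →L[ℂ] H) x = x := by
  constructor
  · rintro ⟨y, rfl⟩
    exact proj_apply_apply hP y
  · intro h
    exact ⟨x, h⟩

theorem isClosed_range (hP : IsStarProjection P) :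
    IsClosed (LinearMap.range ((P : H →L[ℂ] H) : H →ₗ[ℂ] H) : Set H) := by
  have : (LinearMap.range ((P : H →L[ℂ] H) : H →ₗ[ℂ] H) : Set H) =
      {x | (P : H →L[ℂ] H) x = x} := by
    ext x
    exact mem_range_iff hP
  rw [this]
  exact isClosed_eq (P : H →L[ℂ] H).continuous continuous_id

theorem eq_proj_range (hP : IsStarProjection P) : P = proj (affiliated_range P) := by
  apply Subtype.ext
  apply ContinuousLinearMap.ext
  intro x
  symm
  refine Submodule.eq_starProjection_of_mem_orthogonal
    (Submodule.le_topologicalClosure _ ⟨x, rfl⟩) ?_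
  rw [Submodule.orthogonal_closure, Submodule.mem_orthogonal]
  rintro _ ⟨y, rfl⟩
  change inner ℂ ((P : H →L[ℂ] H) y) (x - (P : H →L[ℂ] H) x) = 0
  rw [proj_inner hP, map_sub, proj_apply_apply hP, sub_self, inner_zero_right]

theorem trace_eq_dim_range (hP : IsStarProjection P) :
    τ P = dim τ (LinearMap.range ((P : H →L[ℂ] H) : H →ₗ[ℂ] H)) := by
  rw [dim_eq (affiliated_range P), ← eq_proj_range hP]

end StarProjection

theorem dim_closure {V : Submodule ℂ H} (hV : Affiliated N V) :
    dim τ V.topologicalClosure = dim τ V := by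
  rw [dim_eq hV, dim_eq hV.closure]
  congr 1
  exact Subtype.ext (starProjection_congr
    V.isClosed_topologicalClosure.submodule_topologicalClosure_eq)

theorem dim_bot : dim τ (⊥ : Submodule ℂ H) = 0 := by
  rw [dim_eq affiliated_bot]
  have h : proj (affiliated_bot (N := N)) = 0 := by
    apply Subtype.ext
    apply ContinuousLinearMap.ext
    intro x
    exact proj_apply_of_mem_orthogonal affiliated_bot (by simp)
  rw [h, τ.map_smul 0 0 0 le_rfl (by simp)]
  simp

/-- The projection onto `W` is the sum of the projections onto the closure of `V` and onto W ⊖ V,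
and the trace is additive. -/
theorem dim_add_of_le {V W : Submodule ℂ H} (hV : Affiliated N V) (hW : Affiliated N W)
    (hc : IsClosed (W : Set H)) (h : V ≤ W) : dim τ W = dim τ V + dim τ (W ⊓ Vᗮ) := by
  have hU := hW.inf hV.orthogonal
  have hUc : IsClosed ((W ⊓ Vᗮ : Submodule ℂ H) : Set H) := hc.inter V.isClosed_orthogonal
  rw [dim_eq hV, dim_eq hW, dim_eq hU, ← τ.map_add _ _ (proj_nonneg hV) (proj_nonneg hU)]
  congr 1
  apply Subtype.ext
  apply ContinuousLinearMap.ext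
  intro x
  have hpV : ∀ z, (proj hV : H →L[ℂ] H) z ∈ V.topologicalClosure :=
    Submodule.starProjection_apply_mem _
  have hVW : V.topologicalClosure ≤ W := V.topologicalClosure_minimal h hc
  have hq := proj_mem hU hUc x
  refine Submodule.eq_starProjection_of_mem_orthogonal
    (W.le_topologicalClosure (W.add_mem (hVW (hpV x)) hq.1)) ?_
  change x - ((proj hV : H →L[ℂ] H) x + (proj hU : H →L[ℂ] H) x) ∈ _
  rw [Submodule.orthogonal_closure, Submodule.mem_orthogonal]
  intro w hw
  set p := (proj hV : H →L[ℂ] H) x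
  set q := (proj hU : H →L[ℂ] H) x
  set u := (proj hV : H →L[ℂ] H) w
  have hwu : w - u ∈ W ⊓ Vᗮ := ⟨W.sub_mem hw (hVW (hpV w)), sub_proj_mem hV w⟩
  have e1 : inner ℂ u (x - p) = 0 := by
    refine (Submodule.mem_orthogonal _ _).1 ?_ u (hpV w)
    rw [Submodule.orthogonal_closure]
    exact sub_proj_mem hV x
  have e2 : inner ℂ u q = 0 := by
    refine (Submodule.mem_orthogonal _ _).1 ?_ u (hpV w)
    rw [Submodule.orthogonal_closure]
    exact hq.2
  have e3 : inner ℂ (w - u) (x - q) = 0 :=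
    (Submodule.mem_orthogonal _ _).1 (sub_proj_mem hU x) _ hwu
  have e4 : inner ℂ (w - u) p = 0 := by
    have := hwu.2
    rw [← Submodule.orthogonal_closure] at this
    exact (Submodule.mem_orthogonal' _ _).1 this _ (hpV x)
  have : inner ℂ w (x - (p + q)) =
      inner ℂ u (x - p) - inner ℂ u q + (inner ℂ (w - u) (x - q) - inner ℂ (w - u) p) := by
    simp only [inner_sub_right, inner_sub_left, inner_add_right]
    ring
  rw [this, e1, e2, e3, e4]
  simp

theorem dim_mono {V W : Submodule ℂ H} (hV : Affiliated N V) (hW : Affiliated N W) (h : V ≤ W) :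
    dim τ V ≤ dim τ W := by
  rw [← dim_closure hW, dim_add_of_le hV hW.closure W.isClosed_topologicalClosure
    (h.trans W.le_topologicalClosure)]
  exact le_self_add

/-- Rank–nullity. -/
theorem dim_ker_add_dim_map {V : Submodule ℂ H} (hV : Affiliated N V) (hc : IsClosed (V : Set H))
    (T : N) : dim τ V = dim τ (V ⊓ LinearMap.ker ((T : H →L[ℂ] H) : H →ₗ[ℂ] H)) +
      dim τ (V.map ((T : H →L[ℂ] H) : H →ₗ[ℂ] H)) := by
  rw [dim_add_of_le (hV.inf (affiliated_ker T)) hV hc inf_le_left]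
  congr 1
  -- Apply `dim_range` to T * proj hV: its range is TV, and the orthogonal complement of its kernel
  -- is V ⊖ (V ∩ ker T).
  have h1 : V.map ((T : H →L[ℂ] H) : H →ₗ[ℂ] H) =
      LinearMap.range (((T * proj hV : N) : H →L[ℂ] H) : H →ₗ[ℂ] H) := by
    ext z
    constructor
    · rintro ⟨v, hv, rfl⟩
      exact ⟨v, congrArg (T : H →L[ℂ] H) (proj_apply_of_mem hV hv)⟩
    · rintro ⟨v, rfl⟩
      exact ⟨_, proj_mem hV hc v, rfl⟩
  have h2 : LinearMap.ker (((T * proj hV : N) : H →L[ℂ] H) : H →ₗ[ℂ] H) =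
      (V ⊓ LinearMap.ker ((T : H →L[ℂ] H) : H →ₗ[ℂ] H)) ⊔ Vᗮ := by
    apply le_antisymm
    · intro z hz
      rw [← add_sub_cancel ((proj hV : H →L[ℂ] H) z) z]
      exact Submodule.add_mem_sup ⟨proj_mem hV hc z, hz⟩ (sub_proj_mem hV z)
    · refine sup_le (fun z hz => ?_) (fun z hz => ?_)
      · change (T : H →L[ℂ] H) ((proj hV : H →L[ℂ] H) z) = 0
        rw [proj_apply_of_mem hV hz.1]
        exact hz.2
      · change (T : H →L[ℂ] H) ((proj hV : H →L[ℂ] H) z) = 0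
        rw [proj_apply_of_mem_orthogonal hV hz, map_zero]
  rw [h1, dim_range, h2, ← Submodule.inf_orthogonal, Submodule.orthogonal_orthogonal_eq_closure,
    hc.submodule_topologicalClosure_eq, inf_comm]

theorem dim_map_of_inf_ker_eq_bot {V : Submodule ℂ H} (hV : Affiliated N V)
    (hc : IsClosed (V : Set H)) (T : N)
    (h : V ⊓ LinearMap.ker ((T : H →L[ℂ] H) : H →ₗ[ℂ] H) = ⊥) :
    dim τ (V.map ((T : H →L[ℂ] H) : H →ₗ[ℂ] H)) = dim τ V := by
  rw [dim_ker_add_dim_map hV hc T, h, dim_bot, zero_add]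

theorem ker_one_sub_proj {E : Submodule ℂ H} (hE : Affiliated N E) (hc : IsClosed (E : Set H)) :
    LinearMap.ker (((1 - proj hE : N) : H →L[ℂ] H) : H →ₗ[ℂ] H) = E := by
  ext x
  change x - (proj hE : H →L[ℂ] H) x = 0 ↔ _
  constructor
  · intro h
    rw [sub_eq_zero.1 h]
    exact proj_mem hE hc x
  · intro h
    rw [proj_apply_of_mem hE h, sub_self]

/-- Rank–nullity on `X` for the projection 1 - proj E: the kernel part is X ∩ E, and the image lies
in W ⊖ E. -/
theorem dim_le_dim_inf_add {X E W : Submodule ℂ H} (hX : Affiliated N X) (hE : Affiliated N E)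
    (hW : Affiliated N W) (hXc : IsClosed (X : Set H)) (hEc : IsClosed (E : Set H))
    (hXW : X ≤ W) (hEW : E ≤ W) : dim τ X ≤ dim τ (X ⊓ E) + dim τ (W ⊓ Eᗮ) := by
  rw [dim_ker_add_dim_map hX hXc (1 - proj hE), ker_one_sub_proj hE hEc]
  gcongr
  refine dim_mono (hX.map _) (hW.inf hE.orthogonal) ?_
  rintro _ ⟨x, hx, rfl⟩
  exact ⟨W.sub_mem (hXW hx) (hEW (proj_mem hE hEc x)), sub_proj_mem hE x⟩

theorem dim_le_dim_inf_add_top {X E : Submodule ℂ H} (hX : Affiliated N X) (hE : Affiliated N E)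
    (hXc : IsClosed (X : Set H)) (hEc : IsClosed (E : Set H)) :
    dim τ X ≤ dim τ (X ⊓ E) + dim τ Eᗮ := by
  simpa using dim_le_dim_inf_add (W := ⊤) hX hE affiliated_top hXc hEc le_top le_top

theorem dim_le_of_inf_eq_bot {X E W : Submodule ℂ H} (hX : Affiliated N X) (hE : Affiliated N E)
    (hW : Affiliated N W) (hXc : IsClosed (X : Set H)) (hEc : IsClosed (E : Set H))
    (hXW : X ≤ W) (hEW : E ≤ W) (h : X ⊓ E = ⊥) : dim τ X ≤ dim τ (W ⊓ Eᗮ) := by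
  simpa [h, dim_bot] using dim_le_dim_inf_add (τ := τ) hX hE hW hXc hEc hXW hEW

/-- Closed affiliated subspaces whose orthogonal complement has finite dimension. -/
structure Cofinite (τ : FNSTrace N) (E : Submodule ℂ H) : Prop where
  affiliated : Affiliated N E
  isClosed : IsClosed (E : Set H)
  dim_lt : dim τ Eᗮ < ∞

theorem cofinite_top : Cofinite τ (⊤ : Submodule ℂ H) :=
  ⟨affiliated_top, isClosed_univ, by simp [dim_bot]⟩

/-- Cutting (E ∩ F)ᗮ down by `E` and then by `F` leaves only 0, and each cut costs a finite
dimension. -/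
theorem Cofinite.inf {E F : Submodule ℂ H} (hE : Cofinite τ E) (hF : Cofinite τ F) :
    Cofinite τ (E ⊓ F) := by
  have h := hE.affiliated.inf hF.affiliated
  refine ⟨h, hE.isClosed.inter hF.isClosed, ?_⟩
  have h1 := dim_le_dim_inf_add_top (τ := τ) h.orthogonal hE.affiliated
    (Submodule.isClosed_orthogonal _) hE.isClosed
  have h2 := dim_le_dim_inf_add_top (τ := τ) (h.orthogonal.inf hE.affiliated) hF.affiliated
    ((Submodule.isClosed_orthogonal _).inter hE.isClosed) hF.isClosed
  have h3 : (E ⊓ F)ᗮ ⊓ E ⊓ F = ⊥ := by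
    rw [inf_assoc, inf_comm, Submodule.inf_orthogonal_eq_bot]
  rw [h3, dim_bot, zero_add] at h2
  exact h1.trans_lt (ENNReal.add_lt_top.2 ⟨h2.trans_lt hF.dim_lt, hE.dim_lt⟩)

/-- The preimage is the kernel of (1 - proj E)T, whose range lies in Eᗮ; `dim_range` carries the
bound over to the complement of the kernel. -/
theorem Cofinite.comap {E : Submodule ℂ H} (hE : Cofinite τ E) (T : N) :
    Cofinite τ (E.comap ((T : H →L[ℂ] H) : H →ₗ[ℂ] H)) := by
  refine ⟨hE.affiliated.comap T, hE.isClosed.preimage (T : H →L[ℂ] H).continuous, ?_⟩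
  have h : E.comap ((T : H →L[ℂ] H) : H →ₗ[ℂ] H) =
      LinearMap.ker ((((1 - proj hE.affiliated) * T : N) : H →L[ℂ] H) : H →ₗ[ℂ] H) := by
    ext x
    have := SetLike.ext_iff.1 (ker_one_sub_proj hE.affiliated hE.isClosed) ((T : H →L[ℂ] H) x)
    exact this.symm
  rw [h, ← dim_range]
  refine (dim_mono (affiliated_range _) hE.affiliated.orthogonal ?_).trans_lt hE.dim_lt
  rintro _ ⟨x, rfl⟩
  exact sub_proj_mem hE.affiliated _

theorem Cofinite.dim_relative_lt {E W : Submodule ℂ H} (hE : Cofinite τ E) (hW : Affiliated N W)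
    (hWc : IsClosed (W : Set H)) : dim τ (W ⊓ (W ⊓ E)ᗮ) < ∞ := by
  have h := dim_le_dim_inf_add_top (τ := τ) (hW.inf (hW.inf hE.affiliated).orthogonal)
    hE.affiliated (hWc.inter (Submodule.isClosed_orthogonal _)) hE.isClosed
  have h1 : W ⊓ (W ⊓ E)ᗮ ⊓ E = ⊥ := by
    rw [inf_right_comm, Submodule.inf_orthogonal_eq_bot]
  rw [h1, dim_bot, zero_add] at h
  exact h.trans_lt hE.dim_lt

theorem cofinite_ker_of_trace_lt {p : N} (hp : IsStarProjection p) (h : τ p < ∞) :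
    Cofinite τ (LinearMap.ker ((p : H →L[ℂ] H) : H →ₗ[ℂ] H)) :=
  ⟨affiliated_ker p, (p : H →L[ℂ] H).isClosed_ker, by
    rwa [← dim_range, ← trace_eq_dim_range hp]⟩

end Dimension

/-! ### From the quotient norm to estimates on cofinite subspaces -/

section CompactIdeal

variable {H : Type*} [NormedAddCommGroup H] [InnerProductSpace ℂ H] [CompleteSpace H]
  {N : VonNeumannAlgebra H}

/-- The elements of `N` that are arbitrarily small on cofinite subspaces. -/
def cofinitelySmall (τ : FNSTrace N) : Ideal N where
  carrier := {k | ∀ ε : ℝ, 0 < ε → ∃ E, Cofinite τ E ∧ ∀ x ∈ E, ‖(k : H →L[ℂ] H) x‖ ≤ ε * ‖x‖}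
  zero_mem' := fun ε hε => ⟨⊤, cofinite_top, fun x _ => by
    simpa using mul_nonneg hε.le (norm_nonneg x)⟩
  add_mem' := by
    intro k l hk hl ε hε
    obtain ⟨E, hE, hkE⟩ := hk (ε / 2) (by positivity)
    obtain ⟨F, hF, hlF⟩ := hl (ε / 2) (by positivity)
    refine ⟨E ⊓ F, hE.inf hF, fun x hx => ?_⟩
    calc ‖(k : H →L[ℂ] H) x + (l : H →L[ℂ] H) x‖
        ≤ ε / 2 * ‖x‖ + ε / 2 * ‖x‖ := norm_add_le_of_le (hkE x hx.1) (hlF x hx.2)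
      _ = ε * ‖x‖ := by ring
  smul_mem' := by
    intro a k hk ε hε
    obtain ⟨E, hE, hkE⟩ := hk (ε / (‖(a : H →L[ℂ] H)‖ + 1)) (by positivity)
    refine ⟨E, hE, fun x hx => ?_⟩
    calc ‖(a : H →L[ℂ] H) ((k : H →L[ℂ] H) x)‖
        ≤ (‖(a : H →L[ℂ] H)‖ + 1) * (ε / (‖(a : H →L[ℂ] H)‖ + 1) * ‖x‖) :=
          (a : H →L[ℂ] H).le_of_opNorm_le_of_le (by linarith) (hkE x hx)
      _ = ε * ‖x‖ := by field_simp

theorem cofinitelySmall_isTwoSided (τ : FNSTrace N) : (cofinitelySmall τ).IsTwoSided where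
  mul_mem_of_left {k} b hk := by
    intro ε hε
    obtain ⟨E, hE, hkE⟩ := hk (ε / (‖(b : H →L[ℂ] H)‖ + 1)) (by positivity)
    refine ⟨_, hE.comap b, fun x hx => ?_⟩
    calc ‖(k : H →L[ℂ] H) ((b : H →L[ℂ] H) x)‖
        ≤ ε / (‖(b : H →L[ℂ] H)‖ + 1) * ‖(b : H →L[ℂ] H) x‖ := hkE _ hx
      _ ≤ ε / (‖(b : H →L[ℂ] H)‖ + 1) * ((‖(b : H →L[ℂ] H)‖ + 1) * ‖x‖) := by
          gcongr
          exact (b : H →L[ℂ] H).le_of_opNorm_le (by linarith) x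
      _ = ε * ‖x‖ := by field_simp

theorem isClosed_cofinitelySmall (τ : FNSTrace N) : IsClosed (cofinitelySmall τ : Set N) := by
  refine isClosed_of_closure_subset fun k hk ε hε => ?_
  obtain ⟨l, hl, hkl⟩ := Metric.mem_closure_iff.1 hk (ε / 2) (by positivity)
  obtain ⟨E, hE, hlE⟩ := hl (ε / 2) (by positivity)
  refine ⟨E, hE, fun x hx => ?_⟩
  rw [dist_eq_norm] at hkl
  have h1 : ‖((k : H →L[ℂ] H) - l) x‖ ≤ ε / 2 * ‖x‖ :=
    ((k : H →L[ℂ] H) - l).le_of_opNorm_le hkl.le x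
  calc ‖(k : H →L[ℂ] H) x‖ = ‖((k : H →L[ℂ] H) - l) x + (l : H →L[ℂ] H) x‖ := by simp
    _ ≤ ε / 2 * ‖x‖ + ε / 2 * ‖x‖ := norm_add_le_of_le h1 (hlE x hx)
    _ = ε * ‖x‖ := by ring

/-- The right side is a closed two-sided ideal, and it contains every finite-trace projection
because such a projection vanishes on its own cofinite kernel. -/
theorem compactIdeal_le_cofinitelySmall (τ : FNSTrace N) :
    compactIdeal τ ≤ cofinitelySmall τ := by
  refine sInf_le ⟨cofinitelySmall_isTwoSided τ, isClosed_cofinitelySmall τ, ?_⟩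
  intro p hp hpτ ε hε
  refine ⟨_, cofinite_ker_of_trace_lt hp hpτ, fun x hx => ?_⟩
  have hx' : (p : H →L[ℂ] H) x = 0 := hx
  rw [hx', norm_zero]
  positivity

/-- Choose a representative `B` of the class of `A` with ‖B‖ < r. The compact difference A - B costs
only half of the gap r - ‖B‖ on some cofinite subspace. -/
theorem exists_cofinite_of_norm_calkinMap_lt {τ : FNSTrace N} {A : N} {r : ℝ}
    (h : ‖calkinMap τ A‖ < r) :
    ∃ c < r, ∃ E, Cofinite τ E ∧ ∀ x ∈ E, ‖(A : H →L[ℂ] H) x‖ ≤ c * ‖x‖ := by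
  obtain ⟨B, hB, hr⟩ := Submodule.Quotient.norm_mk_lt (calkinMap τ A) (sub_pos.2 h)
  rw [add_sub_cancel] at hr
  have hk : A - B ∈ compactIdeal τ := by
    rw [← neg_sub]
    exact neg_mem ((Submodule.Quotient.eq _).1 hB)
  obtain ⟨E, hE, hkE⟩ := compactIdeal_le_cofinitelySmall τ hk ((r - ‖B‖) / 2)
    (half_pos (sub_pos.2 hr))
  refine ⟨‖B‖ + (r - ‖B‖) / 2, by linarith, E, hE, fun x hx => ?_⟩
  have h1 : ‖(B : H →L[ℂ] H) x‖ ≤ ‖B‖ * ‖x‖ := (B : H →L[ℂ] H).le_opNorm x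
  have h2 := hkE x hx
  calc ‖(A : H →L[ℂ] H) x‖ = ‖(B : H →L[ℂ] H) x + ((A - B : N) : H →L[ℂ] H) x‖ := by
        congr 1
        change _ = (B : H →L[ℂ] H) x + ((A : H →L[ℂ] H) x - (B : H →L[ℂ] H) x)
        abel
    _ ≤ ‖B‖ * ‖x‖ + (r - ‖B‖) / 2 * ‖x‖ := norm_add_le_of_le h1 h2
    _ = _ := by ring

end CompactIdeal

/-! ### Essential codimension by counting dimensions -/

section Index

variable {H : Type*} [NormedAddCommGroup H] [InnerProductSpace ℂ H] [CompleteSpace H]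
  {N : VonNeumannAlgebra H} {τ : FNSTrace N}

/-- The range of an element of `N`. -/
abbrev ran (T : N) : Submodule ℂ H := LinearMap.range ((T : H →L[ℂ] H) : H →ₗ[ℂ] H)

/-- The image of a subspace under an element of `N`. -/
abbrev image (T : N) (E : Submodule ℂ H) : Submodule ℂ H :=
  E.map ((T : H →L[ℂ] H) : H →ₗ[ℂ] H)

/-- `T` differs from the identity on `E` by a strict contraction. -/
def NearId (T : N) (E : Submodule ℂ H) : Prop :=
  ∃ c < (1 : ℝ), ∀ x ∈ E, ‖(T : H →L[ℂ] H) x - x‖ ≤ c * ‖x‖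

theorem NearId.mono {T : N} {E F : Submodule ℂ H} (h : NearId T F) (hEF : E ≤ F) : NearId T E := by
  obtain ⟨c, hc, hE⟩ := h
  exact ⟨c, hc, fun x hx => hE x (hEF hx)⟩

/-- If Tx is orthogonal to x, then ‖Tx - x‖ ≥ ‖x‖. This orthogonal form, stronger than injectivity,
is what compares the images of two operators. -/
theorem NearId.eq_zero_of_inner {T : N} {E : Submodule ℂ H} (h : NearId T E) {x : H} (hx : x ∈ E)
    (h0 : inner ℂ x ((T : H →L[ℂ] H) x) = 0) : x = 0 := by
  obtain ⟨c, hc, hE⟩ := h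
  by_contra hne
  have hpos : 0 < ‖x‖ := norm_pos_iff.2 hne
  have h1 : ‖inner ℂ x ((T : H →L[ℂ] H) x - x)‖ ≤ ‖x‖ * ‖(T : H →L[ℂ] H) x - x‖ :=
    norm_inner_le_norm _ _
  rw [inner_sub_right, h0, zero_sub, norm_neg, inner_self_eq_norm_sq_to_K] at h1
  have h2 : ‖((‖x‖ : ℂ)) ^ 2‖ = ‖x‖ * ‖x‖ := by
    rw [norm_pow, Complex.norm_real, norm_norm, sq]
  have h3 : ‖x‖ * ‖x‖ ≤ ‖x‖ * ‖(T : H →L[ℂ] H) x - x‖ := h2 ▸ h1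
  have h4 := le_of_mul_le_mul_left h3 hpos
  have h5 := hE x hx
  nlinarith

theorem NearId.eq_zero {T : N} {E : Submodule ℂ H} (h : NearId T E) {x : H} (hx : x ∈ E)
    (h0 : (T : H →L[ℂ] H) x = 0) : x = 0 :=
  h.eq_zero_of_inner hx (by rw [h0, inner_zero_right])

theorem NearId.inf_ker {T : N} {E : Submodule ℂ H} (h : NearId T E) :
    E ⊓ LinearMap.ker ((T : H →L[ℂ] H) : H →ₗ[ℂ] H) = ⊥ :=
  (Submodule.eq_bot_iff _).2 fun _ hx => h.eq_zero hx.1 hx.2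

/-- On `E` the operator is bounded below by 1 - c > 0. -/
theorem NearId.isClosed_image {T : N} {E : Submodule ℂ H} (h : NearId T E)
    (hc : IsClosed (E : Set H)) : IsClosed (image T E : Set H) := by
  obtain ⟨c, hc1, hE⟩ := h
  have : CompleteSpace E := hc.completeSpace_coe
  let f : E →L[ℂ] H := (T : H →L[ℂ] H).comp E.subtypeL
  have hK : (0 : ℝ) ≤ (1 - c)⁻¹ := inv_nonneg.2 (by linarith)
  have hf : AntilipschitzWith ⟨(1 - c)⁻¹, hK⟩ f := by
    refine f.antilipschitz_of_bound fun x => ?_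
    change ‖(x : H)‖ ≤ (1 - c)⁻¹ * ‖(T : H →L[ℂ] H) x‖
    rw [le_inv_mul_iff₀ (by linarith)]
    have h1 := hE x x.2
    have h2 := norm_sub_norm_le (x : H) ((T : H →L[ℂ] H) x)
    rw [norm_sub_rev] at h2
    linarith
  have := hf.isClosed_range f.uniformContinuous
  convert this using 1
  ext z
  constructor
  · rintro ⟨x, hx, rfl⟩
    exact ⟨⟨x, hx⟩, rfl⟩
  · rintro ⟨x, rfl⟩
    exact ⟨x, x.2, rfl⟩

theorem trace_kerProj (Q T : N) : τ (kerProj Q T) = dim τ (kerOn Q T) :=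
  (dim_eq ((affiliated_ker T).inf (affiliated_range Q))).symm

theorem kerOn_mul {P Q : N} (hQ : IsStarProjection Q) :
    kerOn Q (P * Q) = ran Q ⊓ LinearMap.ker ((P : H →L[ℂ] H) : H →ₗ[ℂ] H) := by
  ext x
  constructor
  · rintro ⟨h1, h2⟩
    refine ⟨h2, ?_⟩
    have h1' : (P : H →L[ℂ] H) ((Q : H →L[ℂ] H) x) = 0 := h1
    rwa [(mem_range_iff hQ).1 h2] at h1'
  · rintro ⟨h1, h2⟩
    refine ⟨?_, h1⟩
    change (P : H →L[ℂ] H) ((Q : H →L[ℂ] H) x) = 0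
    rwa [(mem_range_iff hQ).1 h1]

theorem kerOn_star_mul {P Q : N} (hP : IsStarProjection P) (hQ : IsStarProjection Q) :
    kerOn P (star (P * Q)) = ran P ⊓ LinearMap.ker ((Q : H →L[ℂ] H) : H →ₗ[ℂ] H) := by
  rw [star_mul, hP.isSelfAdjoint.star_eq, hQ.isSelfAdjoint.star_eq, kerOn_mul hP]

theorem image_le_ran (P : N) (E : Submodule ℂ H) : image P E ≤ ran P := by
  rintro _ ⟨x, -, rfl⟩
  exact ⟨x, rfl⟩

/-- Counting dimensions along a cofinite subspace on which `P` is close to the identity. -/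
theorem dim_add_dim_ker {P Q : N} (hP : IsStarProjection P) (hQ : IsStarProjection Q)
    {E : Submodule ℂ H} (hE : Affiliated N E) (hEc : IsClosed (E : Set H)) (hEQ : E ≤ ran Q)
    (hPE : NearId P E) :
    dim τ (ran Q ⊓ Eᗮ) + dim τ (ran P ⊓ LinearMap.ker ((Q : H →L[ℂ] H) : H →ₗ[ℂ] H)) =
      dim τ (ran P ⊓ (image P E)ᗮ) +
        dim τ (ran Q ⊓ LinearMap.ker ((P : H →L[ℂ] H) : H →ₗ[ℂ] H)) := by
  have hF := hE.map P
  have hFc := hPE.isClosed_image hEc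
  have hQa := affiliated_range Q
  have hPa := affiliated_range P
  -- `S` is the map induced by `P` from ran Q ⊖ E to ran P ⊖ PE. Its kernel there is a copy of ran Q
  -- ∩ ker P and its cokernel is ran P ∩ ker Q, so rank–nullity for `S` is the claim.
  set S : N := (1 - proj hF) * P with hS
  have hSapp : ∀ x, (S : H →L[ℂ] H) x =
      (P : H →L[ℂ] H) x - (proj hF : H →L[ℂ] H) ((P : H →L[ℂ] H) x) := fun x => rfl
  have hSE : ∀ x ∈ E, (S : H →L[ℂ] H) x = 0 := fun x hx => by
    have hx' : (P : H →L[ℂ] H) x ∈ image P E := ⟨x, hx, rfl⟩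
    rw [hSapp, proj_apply_of_mem hF hx', sub_self]
  set Z := ran Q ⊓ LinearMap.ker ((P : H →L[ℂ] H) : H →ₗ[ℂ] H) with hZ
  have hZa : Affiliated N Z := hQa.inf (affiliated_ker P)
  have hZc : IsClosed (Z : Set H) := (isClosed_range hQ).inter (P : H →L[ℂ] H).isClosed_ker
  have hW : Affiliated N (ran Q ⊓ Eᗮ) := hQa.inf hE.orthogonal
  have hWc : IsClosed ((ran Q ⊓ Eᗮ : Submodule ℂ H) : Set H) :=
    (isClosed_range hQ).inter E.isClosed_orthogonal
  have hker : (ran Q ⊓ Eᗮ) ⊓ LinearMap.ker ((S : H →L[ℂ] H) : H →ₗ[ℂ] H) =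
      image (1 - proj hE) Z := by
    ext w
    constructor
    · rintro ⟨⟨hwQ, hwE⟩, hw⟩
      have hw' : (P : H →L[ℂ] H) w - (proj hF : H →L[ℂ] H) ((P : H →L[ℂ] H) w) = 0 := hw
      have hm := proj_mem hF hFc ((P : H →L[ℂ] H) w)
      rw [← sub_eq_zero.1 hw'] at hm
      obtain ⟨e, he, hew⟩ := hm
      have hew' : (P : H →L[ℂ] H) e = (P : H →L[ℂ] H) w := hew
      refine ⟨w - e, ⟨Submodule.sub_mem _ hwQ (hEQ he), ?_⟩, ?_⟩
      · change (P : H →L[ℂ] H) (w - e) = 0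
        rw [map_sub, hew', sub_self]
      · change (w - e) - (proj hE : H →L[ℂ] H) (w - e) = w
        rw [map_sub, proj_apply_of_mem hE he, proj_apply_of_mem_orthogonal hE hwE]
        abel
    · rintro ⟨z, ⟨hzQ, hzP⟩, rfl⟩
      have hp := proj_mem hE hEc z
      refine ⟨⟨Submodule.sub_mem _ hzQ (hEQ hp), sub_proj_mem hE z⟩, ?_⟩
      change (S : H →L[ℂ] H) (z - (proj hE : H →L[ℂ] H) z) = 0
      have hz : (P : H →L[ℂ] H) z = 0 := hzP
      rw [map_sub, hSE _ hp, sub_zero, hSapp, hz, map_zero, sub_zero]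
  -- `P` is injective on `E`, so ran Q ∩ ker P meets `E` trivially and keeps its dimension when
  -- projected off `E`.
  have hZE : Z ⊓ LinearMap.ker (((1 - proj hE : N) : H →L[ℂ] H) : H →ₗ[ℂ] H) = ⊥ := by
    rw [ker_one_sub_proj hE hEc, eq_bot_iff]
    rintro x ⟨⟨-, hx⟩, hxE⟩
    exact hPE.eq_zero hxE hx
  have h1 : dim τ (ran Q ⊓ Eᗮ) = dim τ Z + dim τ (image S (ran Q ⊓ Eᗮ)) := by
    rw [dim_ker_add_dim_map hW hWc S, hker, dim_map_of_inf_ker_eq_bot hZa hZc _ hZE]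
  have hle : image S (ran Q ⊓ Eᗮ) ≤ ran P ⊓ (image P E)ᗮ := by
    rintro _ ⟨x, -, rfl⟩
    exact ⟨Submodule.sub_mem _ ⟨x, rfl⟩ (image_le_ran P E (proj_mem hF hFc _)),
      sub_proj_mem hF _⟩
  have hort : ran P ⊓ (image P E)ᗮ ⊓ (image S (ran Q ⊓ Eᗮ))ᗮ =
      ran P ⊓ LinearMap.ker ((Q : H →L[ℂ] H) : H →ₗ[ℂ] H) := by
    ext y
    constructor
    · rintro ⟨⟨hyP, hyF⟩, hyS⟩
      refine ⟨hyP, ?_⟩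
      have hyS' : ∀ x ∈ ran Q, inner ℂ ((S : H →L[ℂ] H) x) y = 0 := by
        intro x hx
        have hp := proj_mem hE hEc x
        have : (S : H →L[ℂ] H) x = (S : H →L[ℂ] H) (x - (proj hE : H →L[ℂ] H) x) := by
          rw [map_sub, hSE _ hp, sub_zero]
        rw [this]
        exact (Submodule.mem_orthogonal _ _).1 hyS _
          ⟨_, ⟨Submodule.sub_mem _ hx (hEQ hp), sub_proj_mem hE x⟩, rfl⟩
      have hyQ : ∀ x ∈ ran Q, inner ℂ x y = 0 := by
        intro x hx
        have h2 := hyS' x hx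
        rw [hSapp, inner_sub_left, (Submodule.mem_orthogonal _ _).1 hyF _ (proj_mem hF hFc _),
          sub_zero, proj_inner hP, (mem_range_iff hP).1 hyP] at h2
        exact h2
      have h3 := hyQ ((Q : H →L[ℂ] H) y) ⟨y, rfl⟩
      rw [proj_inner hQ, ← proj_apply_apply hQ, ← proj_inner hQ] at h3
      exact inner_self_eq_zero.1 h3
    · rintro ⟨hyP, hyQ⟩
      have hyQ' : (Q : H →L[ℂ] H) y = 0 := hyQ
      have key : ∀ x ∈ ran Q, inner ℂ ((P : H →L[ℂ] H) x) y = 0 := by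
        intro x hx
        rw [proj_inner hP, (mem_range_iff hP).1 hyP, ← (mem_range_iff hQ).1 hx, proj_inner hQ,
          hyQ', inner_zero_right]
      have hyF : y ∈ (image P E)ᗮ := by
        rw [Submodule.mem_orthogonal]
        rintro _ ⟨x, hx, rfl⟩
        exact key x (hEQ hx)
      refine ⟨⟨hyP, hyF⟩, ?_⟩
      rw [SetLike.mem_coe, Submodule.mem_orthogonal]
      rintro _ ⟨x, hx, rfl⟩
      change inner ℂ ((P : H →L[ℂ] H) x - (proj hF : H →L[ℂ] H) ((P : H →L[ℂ] H) x)) y = 0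
      rw [inner_sub_left, key x hx.1,
        (Submodule.mem_orthogonal _ _).1 hyF _ (proj_mem hF hFc _), sub_zero]
  have h2 := dim_add_of_le (τ := τ) (hW.map S) (hPa.inf hF.orthogonal)
    ((isClosed_range hP).inter (Submodule.isClosed_orthogonal _)) hle
  rw [hort] at h2
  rw [h1, h2]
  ring

/-- PE is closed and lies in the range of PQ, so its projection witnesses the range condition.
Finiteness of ran Q ∩ ker P comes from its trivial intersection with `E`; `dim_add_dim_ker` then
bounds ran P ∩ ker Q and, once all terms are finite, gives the index by subtraction. -/
theorem isTauFredholm_and_ec_eq {P Q : N} (hP : IsStarProjection P) (hQ : IsStarProjection Q)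
    {E : Submodule ℂ H} (hE : Affiliated N E) (hEc : IsClosed (E : Set H)) (hEQ : E ≤ ran Q)
    (hPE : NearId P E) (hfE : dim τ (ran Q ⊓ Eᗮ) < ∞) (hfF : dim τ (ran P ⊓ (image P E)ᗮ) < ∞) :
    IsTauFredholm τ P Q (P * Q) ∧
      ec τ P Q = (dim τ (ran Q ⊓ Eᗮ)).toReal - (dim τ (ran P ⊓ (image P E)ᗮ)).toReal := by
  have hF := hE.map P
  have hFc := hPE.isClosed_image hEc
  have hQa := affiliated_range Q
  have hPa := affiliated_range P
  have hsum := dim_add_dim_ker (τ := τ) hP hQ hE hEc hEQ hPE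
  have hker : dim τ (ran Q ⊓ LinearMap.ker ((P : H →L[ℂ] H) : H →ₗ[ℂ] H)) < ∞ := by
    refine (dim_le_of_inf_eq_bot (hQa.inf (affiliated_ker P)) hE hQa
      ((isClosed_range hQ).inter (P : H →L[ℂ] H).isClosed_ker) hEc inf_le_left hEQ ?_).trans_lt hfE
    rw [eq_bot_iff]
    rintro x ⟨⟨-, hx⟩, hxE⟩
    exact hPE.eq_zero hxE hx
  have hcoker : dim τ (ran P ⊓ LinearMap.ker ((Q : H →L[ℂ] H) : H →ₗ[ℂ] H)) < ∞ := by
    refine lt_of_le_of_lt le_add_self (hsum.trans_lt (ENNReal.add_lt_top.2 ⟨hfF, hker⟩))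
  constructor
  · refine ⟨?_, ?_, ?_, proj hF, isStarProjection_proj hF, ?_, ?_, ?_⟩
    · rw [mul_assoc, mul_assoc, hQ.isIdempotentElem.eq, ← mul_assoc, hP.isIdempotentElem.eq]
    · rwa [trace_kerProj, kerOn_mul hQ]
    · rwa [trace_kerProj, kerOn_star_mul hP hQ]
    · refine le_of_le_of_eq ?_ (eq_proj_range hP).symm
      exact Submodule.starProjection_le_starProjection_iff.2
        (Submodule.topologicalClosure_mono (image_le_ran P E))
    · have h : P - proj hF = proj (hPa.inf hF.orthogonal) := by
        have hle : image P E ≤ ran P := image_le_ran P E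
        apply Subtype.ext
        apply ContinuousLinearMap.ext
        intro x
        change (P : H →L[ℂ] H) x - (proj hF : H →L[ℂ] H) x = _
        symm
        have hFPx : (proj hF : H →L[ℂ] H) x ∈ ran P := hle (proj_mem hF hFc x)
        refine Submodule.eq_starProjection_of_mem_orthogonal (Submodule.le_topologicalClosure _
          ⟨Submodule.sub_mem _ ⟨x, rfl⟩ hFPx, ?_⟩) ?_
        · rw [SetLike.mem_coe, Submodule.mem_orthogonal]
          intro u hu
          rw [inner_sub_right, ← proj_inner hP, (mem_range_iff hP).1 (hle hu), ← inner_sub_right]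
          exact (Submodule.mem_orthogonal _ _).1 (sub_proj_mem hF x) u hu
        · rw [Submodule.orthogonal_closure, Submodule.mem_orthogonal]
          rintro u ⟨hu, huF⟩
          have e1 : inner ℂ u (x - (P : H →L[ℂ] H) x) = 0 := by
            rw [inner_sub_right, ← proj_inner hP, (mem_range_iff hP).1 hu, sub_self]
          have e2 : inner ℂ u ((proj hF : H →L[ℂ] H) x) = 0 :=
            (Submodule.mem_orthogonal' _ _).1 huF _ (proj_mem hF hFc x)
          rw [← sub_add, inner_add_right, e1, e2, add_zero]
      rw [h, ← dim_eq]
      exact hfF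
    · rw [range_proj hF hFc]
      rintro _ ⟨x, hx, rfl⟩
      refine ⟨x, ?_⟩
      change (P : H →L[ℂ] H) ((Q : H →L[ℂ] H) x) = (P : H →L[ℂ] H) x
      rw [(mem_range_iff hQ).1 (hEQ hx)]
  · rw [ec, index, trace_kerProj, trace_kerProj, kerOn_mul hQ, kerOn_star_mul hP hQ]
    have h := congrArg ENNReal.toReal hsum
    rw [ENNReal.toReal_add hfE.ne hcoker.ne, ENNReal.toReal_add hfF.ne hker.ne] at h
    linarith

/-- On the part of ran P ⊖ PE inside `D`, `Q` is injective and maps into ran Q ⊖ E, because ⟨e, Qx⟩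
= ⟨Pe, x⟩ for e in `E` and x in ran P. What lies outside `D` has finite dimension. -/
theorem dim_ran_inf_orthogonal_image_lt {P Q : N} (hP : IsStarProjection P)
    (hQ : IsStarProjection Q) {E D : Submodule ℂ H} (hE : Affiliated N E) (hEQ : E ≤ ran Q)
    (hD : Cofinite τ D) (hQD : NearId Q (ran P ⊓ D)) (hfE : dim τ (ran Q ⊓ Eᗮ) < ∞) :
    dim τ (ran P ⊓ (image P E)ᗮ) < ∞ := by
  have hF := hE.map P
  have hX : Affiliated N (ran P ⊓ (image P E)ᗮ) := (affiliated_range P).inf hF.orthogonal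
  have hXc : IsClosed ((ran P ⊓ (image P E)ᗮ : Submodule ℂ H) : Set H) :=
    (isClosed_range hP).inter (Submodule.isClosed_orthogonal _)
  refine (dim_le_dim_inf_add_top hX hD.affiliated hXc hD.isClosed).trans_lt
    (ENNReal.add_lt_top.2 ⟨?_, hD.dim_lt⟩)
  have hn : NearId Q (ran P ⊓ (image P E)ᗮ ⊓ D) :=
    hQD.mono fun x hx => ⟨hx.1.1, hx.2⟩
  rw [← dim_map_of_inf_ker_eq_bot (hX.inf hD.affiliated) (hXc.inter hD.isClosed) Q hn.inf_ker]
  refine (dim_mono ((hX.inf hD.affiliated).map Q)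
    ((affiliated_range Q).inf hE.orthogonal) ?_).trans_lt hfE
  rintro _ ⟨x, ⟨⟨hxP, hxF⟩, -⟩, rfl⟩
  refine ⟨⟨x, rfl⟩, ?_⟩
  rw [SetLike.mem_coe, Submodule.mem_orthogonal]
  intro e he
  change inner ℂ e ((Q : H →L[ℂ] H) x) = 0
  rw [← proj_inner hQ, (mem_range_iff hQ).1 (hEQ he), ← (mem_range_iff hP).1 hxP,
    ← proj_inner hP]
  exact (Submodule.mem_orthogonal _ _).1 hxF _ ⟨e, he, rfl⟩

/-- As PS = S, one has ⟨Px, Sx⟩ = ⟨x, Sx⟩, which for x in `E` vanishes only at x = 0. Hence PE meets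
(SE)ᗮ trivially, and SE meets (PE)ᗮ trivially; each fact gives one inequality. -/
theorem dim_ran_inf_orthogonal_image_eq {P S : N} (hP : IsStarProjection P) {E : Submodule ℂ H}
    (hE : Affiliated N E) (hEc : IsClosed (E : Set H)) (hPE : NearId P E) (hSE : NearId S E)
    (hPS : P * S = S) :
    dim τ (ran P ⊓ (image S E)ᗮ) = dim τ (ran P ⊓ (image P E)ᗮ) := by
  have hPSx : ∀ x, (P : H →L[ℂ] H) ((S : H →L[ℂ] H) x) = (S : H →L[ℂ] H) x := fun x =>
    congrArg (fun A : N => (A : H →L[ℂ] H) x) hPS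
  have hSP : image S E ≤ ran P := by
    rintro _ ⟨x, -, rfl⟩
    exact ⟨_, hPSx x⟩
  have hPa := affiliated_range P
  have hPc := isClosed_range hP
  have hin : ∀ x, inner ℂ ((P : H →L[ℂ] H) x) ((S : H →L[ℂ] H) x) =
      inner ℂ x ((S : H →L[ℂ] H) x) := fun x => by rw [proj_inner hP, hPSx]
  apply le_antisymm
  · refine dim_le_of_inf_eq_bot (hPa.inf (hE.map S).orthogonal) (hE.map P) hPa
      (hPc.inter (Submodule.isClosed_orthogonal _)) (hPE.isClosed_image hEc) inf_le_left
      (image_le_ran P E) ?_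
    rw [eq_bot_iff]
    rintro _ ⟨⟨-, h⟩, x, hx, rfl⟩
    have h1 := (Submodule.mem_orthogonal' _ _).1 h _ ⟨x, hx, rfl⟩
    have h2 := hSE.eq_zero_of_inner hx ((hin x).symm.trans h1)
    rw [h2, map_zero]
    exact Submodule.zero_mem _
  · refine dim_le_of_inf_eq_bot (hPa.inf (hE.map P).orthogonal) (hE.map S) hPa
      (hPc.inter (Submodule.isClosed_orthogonal _)) (hSE.isClosed_image hEc) inf_le_left
      hSP ?_
    rw [eq_bot_iff]
    rintro _ ⟨⟨-, h⟩, x, hx, rfl⟩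
    have h1 := (Submodule.mem_orthogonal _ _).1 h _ ⟨x, hx, rfl⟩
    have h2 := hSE.eq_zero_of_inner hx ((hin x).symm.trans h1)
    rw [h2, map_zero]
    exact Submodule.zero_mem _

theorem isTauFredholm_and_ec_add {P₁ P₂ P₃ : N} (h₁ : IsStarProjection P₁)
    (h₂ : IsStarProjection P₂) (h₃ : IsStarProjection P₃)
    (h₁₂ : ‖calkinMap τ P₁ - calkinMap τ P₂‖ < 1 / 2)
    (h₂₃ : ‖calkinMap τ P₂ - calkinMap τ P₃‖ < 1 / 2) :
    IsTauFredholm τ P₁ P₂ (P₁ * P₂) ∧ IsTauFredholm τ P₂ P₃ (P₂ * P₃) ∧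
      IsTauFredholm τ P₁ P₃ (P₁ * P₃) ∧ ec τ P₁ P₃ = ec τ P₁ P₂ + ec τ P₂ P₃ := by
  rw [← map_sub] at h₁₂ h₂₃
  obtain ⟨c, hc, C, hC, hCb⟩ := exists_cofinite_of_norm_calkinMap_lt h₁₂
  obtain ⟨d, hd, D, hD, hDb⟩ := exists_cofinite_of_norm_calkinMap_lt h₂₃
  replace hCb : ∀ x ∈ C, ‖(P₁ : H →L[ℂ] H) x - (P₂ : H →L[ℂ] H) x‖ ≤ c * ‖x‖ := hCb
  replace hDb : ∀ x ∈ D, ‖(P₂ : H →L[ℂ] H) x - (P₃ : H →L[ℂ] H) x‖ ≤ d * ‖x‖ := hDb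
  have hle : ∀ {P : N}, IsStarProjection P → ∀ x, ‖(P : H →L[ℂ] H) x‖ ≤ ‖x‖ := by
    intro P hP x
    rw [eq_proj_range hP]
    have h := ContinuousLinearMap.le_of_opNorm_le _
      (Submodule.starProjection_norm_le (ran P).topologicalClosure) x
    rwa [one_mul] at h
  have hE' := (hD.inf hC).inf (hC.comap P₂)
  -- `D` and `C` control P₂ - P₃ and P₁ - P₂ at x; the preimage of `C` controls P₁ - P₂ at P₂x.
  set E' := D ⊓ C ⊓ C.comap ((P₂ : H →L[ℂ] H) : H →ₗ[ℂ] H)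
  set E := ran P₃ ⊓ E' with hEdef
  have hE : Affiliated N E := (affiliated_range P₃).inf hE'.affiliated
  have hEc : IsClosed (E : Set H) := (isClosed_range h₃).inter hE'.isClosed
  have hE3 : E ≤ ran P₃ := inf_le_left
  have hfE : dim τ (ran P₃ ⊓ Eᗮ) < ∞ :=
    hE'.dim_relative_lt (affiliated_range P₃) (isClosed_range h₃)
  have n12 : NearId P₁ (ran P₂ ⊓ C) := by
    refine ⟨c, by linarith, fun x hx => ?_⟩
    have := hCb x hx.2
    rwa [(mem_range_iff h₂).1 hx.1] at this
  have n21 : NearId P₂ (ran P₁ ⊓ C) := by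
    refine ⟨c, by linarith, fun x hx => ?_⟩
    have := hCb x hx.2
    rwa [(mem_range_iff h₁).1 hx.1, norm_sub_rev] at this
  have n23 : NearId P₂ (ran P₃ ⊓ D) := by
    refine ⟨d, by linarith, fun x hx => ?_⟩
    have := hDb x hx.2
    rwa [(mem_range_iff h₃).1 hx.1] at this
  have n32 : NearId P₃ (ran P₂ ⊓ D) := by
    refine ⟨d, by linarith, fun x hx => ?_⟩
    have := hDb x hx.2
    rwa [(mem_range_iff h₂).1 hx.1, norm_sub_rev] at this
  -- Here and in `n123` the constant 1/2 matters: two errors add up and must stay below 1. The other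
  -- estimates need only a bound below 1.
  have n13 : NearId P₁ E := by
    refine ⟨c + d, by linarith, fun x hx => ?_⟩
    have e1 := hCb x hx.2.1.2
    have e2 := hDb x hx.2.1.1
    rw [(mem_range_iff h₃).1 hx.1] at e2
    rw [add_mul]
    exact (norm_sub_le_norm_sub_add_norm_sub _ _ _).trans (add_le_add e1 e2)
  have n123 : NearId (P₁ * P₂) E := by
    -- The sign of `c` is not known; a nonnegative constant is needed to pass from ‖P₂x‖ to ‖x‖.
    refine ⟨max c 0 + d, by rcases max_cases c 0 with h | h <;> linarith, fun x hx => ?_⟩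
    have e1 := hCb _ hx.2.2
    have e2 := hDb x hx.2.1.1
    rw [(mem_range_iff h₃).1 hx.1] at e2
    change ‖(P₁ : H →L[ℂ] H) ((P₂ : H →L[ℂ] H) x) - (P₂ : H →L[ℂ] H) ((P₂ : H →L[ℂ] H) x)‖ ≤
      c * ‖(P₂ : H →L[ℂ] H) x‖ at e1
    rw [proj_apply_apply h₂] at e1
    have e3 : c * ‖(P₂ : H →L[ℂ] H) x‖ ≤ max c 0 * ‖x‖ :=
      mul_le_mul (le_max_left _ _) (hle h₂ x) (norm_nonneg _) (le_max_right _ _)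
    rw [add_mul]
    exact (norm_sub_le_norm_sub_add_norm_sub _ _ _).trans (add_le_add (e1.trans e3) e2)
  have n23E : NearId P₂ E := n23.mono fun x hx => ⟨hx.1, hx.2.1.1⟩
  have hG : Affiliated N (image P₂ E) := hE.map P₂
  have hGc := n23E.isClosed_image hEc
  have hG2 : image P₂ E ≤ ran P₂ := image_le_ran _ _
  have n12G : NearId P₁ (image P₂ E) := n12.mono fun y hy => ⟨hG2 hy, by
    obtain ⟨x, hx, rfl⟩ := hy
    exact hx.2.2⟩
  have hfG : dim τ (ran P₂ ⊓ (image P₂ E)ᗮ) < ∞ :=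
    dim_ran_inf_orthogonal_image_lt h₂ h₃ hE hE3 hD n32 hfE
  have hfF : dim τ (ran P₁ ⊓ (image P₁ (image P₂ E))ᗮ) < ∞ :=
    dim_ran_inf_orthogonal_image_lt h₁ h₂ hG hG2 hC n21 hfG
  have himage : image P₁ (image P₂ E) = image (P₁ * P₂) E := by
    rw [image, image, ← Submodule.map_comp]
    rfl
  have heq : dim τ (ran P₁ ⊓ (image P₁ (image P₂ E))ᗮ) = dim τ (ran P₁ ⊓ (image P₁ E)ᗮ) := by
    rw [himage]
    exact dim_ran_inf_orthogonal_image_eq h₁ hE hEc n13 n123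
      (by rw [← mul_assoc, h₁.isIdempotentElem.eq])
  obtain ⟨f23, i23⟩ := isTauFredholm_and_ec_eq h₂ h₃ hE hEc hE3 n23E hfE hfG
  obtain ⟨f12, i12⟩ := isTauFredholm_and_ec_eq h₁ h₂ hG hGc hG2 n12G hfG hfF
  obtain ⟨f13, i13⟩ := isTauFredholm_and_ec_eq h₁ h₃ hE hEc hE3 n13 hfE (heq ▸ hfF)
  refine ⟨f12, f23, f13, ?_⟩
  rw [i13, i12, i23, heq]
  ring

end Index

/-! ### Independence of the partition -/

section SpectralFlow

/-- Sums of an interval function that is additive on the intervals of two partitions agree. -/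
theorem sum_partition_eq {a b : ℝ} {k l : ℕ} {t : Fin (k + 1) → ℝ} {s : Fin (l + 1) → ℝ}
    (d : ℝ → ℝ → ℝ) (ht : Monotone t) (hs : Monotone s) (ht0 : t 0 = a) (hs0 : s 0 = a)
    (htk : t (Fin.last k) = b) (hsl : s (Fin.last l) = b)
    (hdt : ∀ i : Fin k, ∀ x ∈ Set.Icc (t i.castSucc) (t i.succ),
      ∀ y ∈ Set.Icc (t i.castSucc) (t i.succ), ∀ z ∈ Set.Icc (t i.castSucc) (t i.succ),
        d x z = d x y + d y z)
    (hds : ∀ i : Fin l, ∀ x ∈ Set.Icc (s i.castSucc) (s i.succ),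
      ∀ y ∈ Set.Icc (s i.castSucc) (s i.succ), ∀ z ∈ Set.Icc (s i.castSucc) (s i.succ),
        d x z = d x y + d y z) :
    ∑ i : Fin k, d (t i.castSucc) (t i.succ) = ∑ j : Fin l, d (s j.castSucc) (s j.succ) := by
  -- Clamping the points of `u` to [p, q] subdivides that interval without forming a merged
  -- partition. By additivity each term is a difference of values of d p, and the sum telescopes.
  have tele : ∀ {m : ℕ} (u : Fin (m + 1) → ℝ) (p q : ℝ), p ≤ q → u 0 ≤ p → q ≤ u (Fin.last m) →
      (∀ x ∈ Set.Icc p q, ∀ y ∈ Set.Icc p q, ∀ z ∈ Set.Icc p q, d x z = d x y + d y z) →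
      ∑ j : Fin m, d (max p (min (u j.castSucc) q)) (max p (min (u j.succ) q)) = d p q := by
    intro m u p q hpq hu0 hum hd
    have hmem : ∀ j, max p (min (u j) q) ∈ Set.Icc p q := fun j =>
      ⟨le_max_left _ _, max_le hpq (min_le_right _ _)⟩
    have hp : p ∈ Set.Icc p q := ⟨le_rfl, hpq⟩
    have h1 : ∀ j : Fin m, d (max p (min (u j.castSucc) q)) (max p (min (u j.succ) q)) =
        d p (max p (min (u j.succ) q)) - d p (max p (min (u j.castSucc) q)) := fun j => by
      rw [hd p hp _ (hmem j.castSucc) _ (hmem j.succ)]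
      ring
    have h2 := Fin.sum_univ_succ (fun j => d p (max p (min (u j) q)))
    have h3 := Fin.sum_univ_castSucc (fun j => d p (max p (min (u j) q)))
    have h0 : d p p = 0 := by linarith [hd p hp p hp p hp]
    have e0 : max p (min (u 0) q) = p := max_eq_left ((min_le_left _ _).trans hu0)
    have e1 : max p (min (u (Fin.last m)) q) = q := by rw [min_eq_right hum, max_eq_right hpq]
    rw [Finset.sum_congr rfl fun j _ => h1 j, Finset.sum_sub_distrib]
    rw [e0, h0] at h2
    rw [e1] at h3
    linarith
  have hL : ∀ i : Fin k, d (t i.castSucc) (t i.succ) = ∑ j : Fin l,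
      d (max (t i.castSucc) (min (s j.castSucc) (t i.succ)))
        (max (t i.castSucc) (min (s j.succ) (t i.succ))) := fun i =>
    (tele s _ _ (ht i.castSucc_le_succ) (hs0.trans_le (ht0 ▸ ht (Fin.zero_le _)))
      (hsl ▸ htk ▸ ht (Fin.le_last _)) (hdt i)).symm
  have hR : ∀ j : Fin l, d (s j.castSucc) (s j.succ) = ∑ i : Fin k,
      d (max (s j.castSucc) (min (t i.castSucc) (s j.succ)))
        (max (s j.castSucc) (min (t i.succ) (s j.succ))) := fun j =>
    (tele t _ _ (hs j.castSucc_le_succ) (ht0.trans_le (hs0 ▸ hs (Fin.zero_le _)))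
      (htk ▸ hsl ▸ hs (Fin.le_last _)) (hds j)).symm
  rw [Finset.sum_congr rfl fun i _ => hL i, Finset.sum_congr rfl fun j _ => hR j,
    Finset.sum_comm]
  refine Finset.sum_congr rfl fun j _ => Finset.sum_congr rfl fun i _ => ?_
  have hi := ht i.castSucc_le_succ
  have hj := hs j.castSucc_le_succ
  have zt : ∀ x ∈ Set.Icc (t i.castSucc) (t i.succ), d x x = 0 := fun x hx => by
    linarith [hdt i x hx x hx x hx]
  have zs : ∀ x ∈ Set.Icc (s j.castSucc) (s j.succ), d x x = 0 := fun x hx => by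
    linarith [hds j x hx x hx x hx]
  -- If the two intervals overlap, both clampings give their intersection. Otherwise each clamping
  -- collapses to a point, possibly a different one, and additivity forces d x x = 0 at both.
  rcases le_total (s j.succ) (t i.castSucc) with h | h
  · rw [max_eq_left ((min_le_left _ _).trans (hj.trans h)), max_eq_left ((min_le_left _ _).trans h),
      zt _ ⟨le_rfl, hi⟩, min_eq_right h, min_eq_right (h.trans hi), max_eq_right hj,
      zs _ ⟨hj, le_rfl⟩]
  rcases le_total (t i.succ) (s j.castSucc) with h' | h'
  · rw [max_eq_left ((min_le_left _ _).trans (hi.trans h')),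
      max_eq_left ((min_le_left _ _).trans h'), zs _ ⟨le_rfl, hj⟩, min_eq_right h',
      min_eq_right (h'.trans hj), max_eq_right hi, zt _ ⟨hi, le_rfl⟩]
  rw [min_eq_left h', min_eq_left h, max_comm (t i.castSucc), max_eq_right (le_min h hi),
    max_eq_right (le_min h' hj), min_comm]

variable {H : Type*} [NormedAddCommGroup H] [InnerProductSpace ℂ H] [CompleteSpace H]
  {N : VonNeumannAlgebra H} {τ : FNSTrace N}

theorem isStarProjection_chi (T : N) : IsStarProjection (chi T) :=
  ⟨Subtype.ext isStarProjection_starProjection.isIdempotentElem.eq,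
    Subtype.ext isStarProjection_starProjection.isSelfAdjoint.star_eq⟩

theorem IsFlowPartition.ec_add {B : ℝ → N} {a b : ℝ} {k : ℕ} {t : Fin (k + 1) → ℝ}
    (ht : IsFlowPartition τ B a b t) (i : Fin k) (x : ℝ)
    (hx : x ∈ Set.Icc (t i.castSucc) (t i.succ)) (y : ℝ)
    (hy : y ∈ Set.Icc (t i.castSucc) (t i.succ)) (z : ℝ)
    (hz : z ∈ Set.Icc (t i.castSucc) (t i.succ)) :
    ec τ (chi (B x)) (chi (B z)) =
      ec τ (chi (B x)) (chi (B y)) + ec τ (chi (B y)) (chi (B z)) :=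
  (isTauFredholm_and_ec_add (isStarProjection_chi _) (isStarProjection_chi _)
    (isStarProjection_chi _) (ht.close i x hx y hy) (ht.close i y hy z hz)).2.2.2

theorem flowSum_eq {B : ℝ → N} {a b : ℝ} {k l : ℕ} {t : Fin (k + 1) → ℝ} {s : Fin (l + 1) → ℝ}
    (ht : IsFlowPartition τ B a b t) (hs : IsFlowPartition τ B a b s) :
    flowSum τ B t = flowSum τ B s :=
  sum_partition_eq (fun x y => ec τ (chi (B x)) (chi (B y))) ht.strictMono.monotone
    hs.strictMono.monotone ht.left hs.left ht.right hs.right ht.ec_add hs.ec_add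

end SpectralFlow

end BreuerFredholm

end

theorem lemma4p2 {H : Type*} [NormedAddCommGroup H] [InnerProductSpace ℂ H] [CompleteSpace H]
    [TopologicalSpace.SeparableSpace H] (N : VonNeumannAlgebra H)
    (τ : BreuerFredholm.FNSTrace N) :
    (∀ P₁ P₂ P₃ : N, IsStarProjection P₁ → IsStarProjection P₂ → IsStarProjection P₃ →
      ‖BreuerFredholm.calkinMap τ P₁ - BreuerFredholm.calkinMap τ P₂‖ < 1 / 2 →
      ‖BreuerFredholm.calkinMap τ P₂ - BreuerFredholm.calkinMap τ P₃‖ < 1 / 2 →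
      BreuerFredholm.IsTauFredholm τ P₁ P₂ (P₁ * P₂) ∧
      BreuerFredholm.IsTauFredholm τ P₂ P₃ (P₂ * P₃) ∧
      BreuerFredholm.IsTauFredholm τ P₁ P₃ (P₁ * P₃) ∧
      BreuerFredholm.ec τ P₁ P₃ = BreuerFredholm.ec τ P₁ P₂ + BreuerFredholm.ec τ P₂ P₃) ∧
    (∀ (a b : ℝ) (B : ℝ → N), a ≤ b → ContinuousOn B (Set.Icc a b) →
      (∀ r ∈ Set.Icc a b, B r ∈ BreuerFredholm.SelfAdjointFredholm τ) →
      ∀ (k l : ℕ) (t : Fin (k + 1) → ℝ) (s : Fin (l + 1) → ℝ),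
        BreuerFredholm.IsFlowPartition τ B a b t →
        BreuerFredholm.IsFlowPartition τ B a b s →
        BreuerFredholm.flowSum τ B t = BreuerFredholm.flowSum τ B s) := by
  refine ⟨fun P₁ P₂ P₃ h₁ h₂ h₃ h₁₂ h₂₃ =>
    BreuerFredholm.isTauFredholm_and_ec_add h₁ h₂ h₃ h₁₂ h₂₃, ?_⟩
  intro a b B _ _ _ k l t s ht hs
  exact BreuerFredholm.flowSum_eq ht hs
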